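/- Let $d\in\mathbb N$ and $r=(r_1,\dots,r_d)$ with integers $r_i\ge 1$. There are constants $C,C'>0$ depending only on $r$ and $d$ such that for every $1\le p\le\infty$, every box $Q=[a_1,b_1]\times\dots\times[a_d,b_d]$ with $a_i<b_i$, and every real-valued $f\in L_p(Q)$, $$C\,W_r(f,\delta)_{p,Q}\ \le\ E_r(f)_{p,Q}\ \le\ C'\,W_r(f,\delta)_{p,Q},\qquad \delta=(b_1-a_1,\dots,b_d-a_d).$$ Here $E_r(f)_{p,Q}=\inf_\varphi\|f-\varphi\|_{L_p(Q)}$, the infimum being taken over all real polynomials $\varphi$ in $d$ variables of degree at most $r_i-1$ in the variable $x_i$ for each $i$, and the total mixed $p$-mean modulus of smoothness is $$W_r(f,t)_{p,Q}=\sum_{\emptyset\ne e\subseteq\{1,\dots,d\}}w_{r(e)}(f,t)_{p,Q},\qquad t\in(0,\infty)^d,$$ where $r(e)_i=r_i$ for $i\in e$ and $r(e)_i=0$ for $i\notin e$. For $k\in\{0,1,2,\dots\}^d$ and $1\le p<\infty$, $$w_k(f,t)_{p,Q}=\Big(\Big(\prod_{i=1}^d t_i^{-1}\Big)\int_{U(t)}\int_{Q_{kh}}|\Delta_h^{k}(f,x)|^p\,dx\,dh\Big)^{1/p},$$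 and $$w_k(f,t)_{\infty,Q}=\sup_{h\in U(t)}\|\Delta_h^{k}f\|_{L_\infty(Q_{kh})},$$ where $U(t)=\{h\in\mathbb R^d:|h_i|\le t_i\text{ for all }i\}$, $kh=(k_1h_1,\dots,k_dh_d)$, $Q_y=\{x\in Q: x_i+y_i\in[a_i,b_i]\text{ for all }i\}$, and $\Delta_h^k=\prod_{i=1}^d\Delta_{h_i,i}^{k_i}$ is the composition of the univariate differences $\Delta_{h_i,i}^{k_i}$, defined by $\Delta_\eta^m(g,s)=\sum_{j=0}^m(-1)^{m-j}\binom mj g(s+j\eta)$ and applied in the variable $x_i$ with the other variables fixed. -/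

import Mathlib

open MeasureTheory
open scoped ENNReal

namespace Whitney

/-- The box `Q = [a₁,b₁] × ... × [a_d,b_d]`. -/
def box {d : ℕ} (a b : Fin d → ℝ) : Set (Fin d → ℝ) :=
  {x | ∀ i, x i ∈ Set.Icc (a i) (b i)}

/-- `Q_y`, the set of all `x ∈ Q` such that `x_i` and `x_i + y_i` lie in `[a_i,b_i]` for all `i`. -/
def shiftBox {d : ℕ} (a b y : Fin d → ℝ) : Set (Fin d → ℝ) :=
  {x | x ∈ box a b ∧ ∀ i, x i + y i ∈ Set.Icc (a i) (b i)}

/-- `P_r`: real polynomials in `d` variables of degree at most `r_i - 1` in the variable `x_i`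
(every exponent of `x_i` that occurs is smaller than `r_i`; the zero polynomial always belongs). -/
def polys {d : ℕ} (r : Fin d → ℕ) : Set (MvPolynomial (Fin d) ℝ) :=
  {φ | ∀ m ∈ φ.support, ∀ i, m i < r i}

/-- The error of best approximation `E_r(f)_{p,Q} = inf_{φ ∈ P_r} ‖f - φ‖_{p,Q}`. -/
noncomputable def bestError {d : ℕ} (r : Fin d → ℕ) (p : ℝ≥0∞) (a b : Fin d → ℝ)
    (f : (Fin d → ℝ) → ℝ) : ℝ≥0∞ :=
  ⨅ φ ∈ polys r, eLpNorm (fun x => f x - MvPolynomial.eval x φ) p (volume.restrict (box a b))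

/-- The univariate difference operator of order `k` and step `η` acting on the variable `x_i`:
`∑_{j=0}^{k} (-1)^(k-j) (k choose j) f(x_1, ..., x_i + j η, ..., x_d)`. -/
noncomputable def coordDiff {d : ℕ} (i : Fin d) (k : ℕ) (η : ℝ)
    (f : (Fin d → ℝ) → ℝ) : (Fin d → ℝ) → ℝ :=
  fun x => ∑ j ∈ Finset.range (k + 1),
    (-1 : ℝ) ^ (k - j) * (k.choose j : ℝ) * f (Function.update x i (x i + (j : ℝ) * η))

/-- The mixed difference operator `Δ_h^r`, the composition over `i = 1, ..., d` of the univariate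
differences of order `r_i` and step `h_i` in the variable `x_i`. -/
noncomputable def mixedDiff {d : ℕ} (r : Fin d → ℕ) (h : Fin d → ℝ)
    (f : (Fin d → ℝ) → ℝ) : (Fin d → ℝ) → ℝ :=
  (List.finRange d).foldr (fun i g => coordDiff i (r i) (h i) g) f

/-- `r(e)`: equal to `r_i` for `i ∈ e` and to `0` for `i ∉ e`. -/
def restrictOrder {d : ℕ} (r : Fin d → ℕ) (e : Finset (Fin d)) : Fin d → ℕ :=
  fun i => if i ∈ e then r i else 0

/-- `U(t)`, the set of all `h` with `|h_i| ≤ t_i` for all `i`. -/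
def stepSet {d : ℕ} (t : Fin d → ℝ) : Set (Fin d → ℝ) :=
  {h | ∀ i, |h i| ≤ t i}

/-- The mixed `p`-mean modulus of smoothness `w_k(f,t)_{p,Q}` of order `k` on the box `Q`:
for `p < ∞` it is
`((∏ i, t_i⁻¹) ∫_{U(t)} ∫_{Q_{kh}} |Δ_h^k(f,x)|^p dx dh)^(1/p)`,
and for `p = ∞` the supremum over `h ∈ U(t)` of the essential supremum norm of `Δ_h^k f`
on `Q_{kh}`. -/
noncomputable def meanModulus {d : ℕ} (k : Fin d → ℕ) (p : ℝ≥0∞) (a b : Fin d → ℝ)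
    (f : (Fin d → ℝ) → ℝ) (t : Fin d → ℝ) : ℝ≥0∞ :=
  if p = ∞ then
    ⨆ h ∈ stepSet t,
      eLpNorm (mixedDiff k h f) ∞ (volume.restrict (shiftBox a b (fun i => (k i : ℝ) * h i)))
  else
    (ENNReal.ofReal (∏ i, (t i)⁻¹) *
      ∫⁻ h in stepSet t, ∫⁻ x in shiftBox a b (fun i => (k i : ℝ) * h i),
        ENNReal.ofReal (|mixedDiff k h f x| ^ p.toReal)) ^ (1 / p.toReal)

/-- The total mixed `p`-mean modulus of smoothness
`W_r(f,t)_{p,Q} = ∑_{∅ ≠ e ⊆ [d]} w_{r(e)}(f,t)_{p,Q}`. -/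
noncomputable def totalMeanModulus {d : ℕ} (r : Fin d → ℕ) (p : ℝ≥0∞) (a b : Fin d → ℝ)
    (f : (Fin d → ℝ) → ℝ) (t : Fin d → ℝ) : ℝ≥0∞ :=
  ∑ e : Finset (Fin d) with e.Nonempty, meanModulus (restrictOrder r e) p a b f t

end Whitney

/-! Lower estimate. For nonempty `e` the difference of order `r(e)` annihilates every admissible
polynomial, so the difference of `f` equals that of `f - φ`, whose norm is at most `2 ^ ∑ r i` times
the norm of `f - φ`. The average over steps costs at most a factor `2 ^ d`, the sum over `e` another
one, and the infimum over `φ` finishes (`totalMeanModulus_le_bestError`).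

Upper estimate. Only the singletons `e = {k}` are needed. On the unit cube, a step in direction `k`
is encoded by a second point `z` through `h k = (z k - x k) / r k`. Up to sign, the difference is
then the deviation of `f x` from a combination of values of `f` at points between `x` and `z` on the
`k`-th axis (`coordDiff_eq_devCoord`). The claim becomes that the error of best approximation is at
most a constant times the sum of the norms of these deviations.

This follows by compactness. Composing the combinations over all coordinates and integrating in `z`
against a continuous density yields an integral operator with continuous kernel, and `f` minus its
image is controlled by the deviations (`exists_continuous_kernel`, `eLpNorm_sub_kernel_le`). If no
constant worked, normalization would give functions of norm at most 2, with deviations tending to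
zero, at distance at least 1 from all polynomials. The exponent may vary along the sequence; on a
probability space all these norms dominate the `L_1` norm, which suffices for Arzelà–Ascoli on the
images. A subsequence therefore approaches a continuous limit, each member in its own norm. The
deviations of the limit vanish, so it is a polynomial on the cube
(`exists_eval_eq_of_devCoord_ae_eq_zero`), a contradiction. Letting the exponent vary is what makes
the constant independent of `p`.

An affine change of variables moves the result to an arbitrary box. The powers of the volume cancel,
and only the Jacobian factor `∏ r i` remains (`eLpNorm_devCoord_le_meanModulus`). -/

namespace Whitney

variable {d : ℕ}

/-! ### Difference operators and the polynomials they annihilate -/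

theorem coordDiff_zero_order (i : Fin d) (η : ℝ) (f : (Fin d → ℝ) → ℝ) :
    coordDiff i 0 η f = f := by
  funext x
  simp [coordDiff]

theorem coordDiff_sub (i : Fin d) (k : ℕ) (η : ℝ) (f g : (Fin d → ℝ) → ℝ) :
    coordDiff i k η (fun x => f x - g x) = fun x => coordDiff i k η f x - coordDiff i k η g x := by
  funext x
  simp only [coordDiff, mul_sub, Finset.sum_sub_distrib]

theorem coordDiff_zero (i : Fin d) (k : ℕ) (η : ℝ) :
    coordDiff i k η (fun _ => 0) = fun _ => 0 := by
  funext x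
  simp [coordDiff]

theorem coordDiff_comm {i j : Fin d} (hij : i ≠ j) (k l : ℕ) (η θ : ℝ)
    (f : (Fin d → ℝ) → ℝ) :
    coordDiff i k η (coordDiff j l θ f) = coordDiff j l θ (coordDiff i k η f) := by
  funext x
  simp only [coordDiff, Finset.mul_sum]
  rw [Finset.sum_comm]
  refine Finset.sum_congr rfl fun m _ => Finset.sum_congr rfl fun n _ => ?_
  rw [Function.update_of_ne hij.symm, Function.update_of_ne hij, Function.update_comm hij]
  ring

/-- The alternating binomial sums annihilate powers below the order. -/
theorem sum_alternating_choose_pow_eq_zero {k n : ℕ} (hn : n < k) (x η : ℝ) :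
    ∑ j ∈ Finset.range (k + 1),
      (-1 : ℝ) ^ (k - j) * (k.choose j : ℝ) * (x + (j : ℝ) * η) ^ n = 0 := by
  set P : Polynomial ℝ := (Polynomial.C x + Polynomial.X * Polynomial.C η) ^ n with hP
  have hdeg : P.natDegree < k := by
    refine lt_of_le_of_lt (Polynomial.natDegree_pow_le_of_le n (m := 1) ?_) (by simpa using hn)
    compute_degree
  have h := congrFun (Polynomial.fwdDiff_iter_eq_zero_of_degree_lt hdeg) 0
  rw [fwdDiff_iter_eq_sum_shift] at h
  simpa [hP, mul_comm η] using h

theorem coordDiff_eval_eq_zero {r : Fin d → ℕ} {φ : MvPolynomial (Fin d) ℝ} (hφ : φ ∈ polys r)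
    (i : Fin d) (η : ℝ) :
    coordDiff i (r i) η (fun x => MvPolynomial.eval x φ) = fun _ => 0 := by
  funext x
  simp only [coordDiff, MvPolynomial.eval_eq, Finset.mul_sum]
  rw [Finset.sum_comm]
  refine Finset.sum_eq_zero fun m hm => ?_
  have h := sum_alternating_choose_pow_eq_zero (hφ m hm i) (x i) η
  calc _ = (φ.coeff m * ∏ j ∈ Finset.univ.erase i, x j ^ m j) *
        ∑ j ∈ Finset.range (r i + 1),
          (-1 : ℝ) ^ (r i - j) * ((r i).choose j : ℝ) * (x i + (j : ℝ) * η) ^ (m i) := by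
        rw [Finset.mul_sum]
        refine Finset.sum_congr rfl fun j _ => ?_
        have : ∏ l ∈ m.support, Function.update x i (x i + (j : ℝ) * η) l ^ m l =
            (x i + (j : ℝ) * η) ^ m i * ∏ l ∈ Finset.univ.erase i, x l ^ m l := by
          rw [Finset.prod_subset (Finset.subset_univ _) (by
            intro l _ hl
            simp [Finsupp.notMem_support_iff.1 hl]),
            ← Finset.mul_prod_erase _ _ (Finset.mem_univ i)]
          congr 1
          · simp
          · refine Finset.prod_congr rfl fun l hl => ?_
            rw [Function.update_of_ne (Finset.ne_of_mem_erase hl)]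
        rw [this]
        ring
    _ = 0 := by rw [h, mul_zero]

theorem foldr_coordDiff_sub (k : Fin d → ℕ) (h : Fin d → ℝ) (l : List (Fin d))
    (f g : (Fin d → ℝ) → ℝ) :
    l.foldr (fun i u => coordDiff i (k i) (h i) u) (fun x => f x - g x) =
      fun x => l.foldr (fun i u => coordDiff i (k i) (h i) u) f x -
        l.foldr (fun i u => coordDiff i (k i) (h i) u) g x := by
  induction l with
  | nil => rfl
  | cons i l ih => simp only [List.foldr_cons, ih, coordDiff_sub]

/-- Differences in distinct coordinates commute, so the annihilating one can be moved inwards until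
it meets `f`. -/
theorem coordDiff_foldr_eq_zero {k : Fin d → ℕ} {h : Fin d → ℝ} {i : Fin d}
    {f : (Fin d → ℝ) → ℝ} (hf : coordDiff i (k i) (h i) f = fun _ => 0) (l : List (Fin d)) :
    coordDiff i (k i) (h i) (l.foldr (fun i u => coordDiff i (k i) (h i) u) f) = fun _ => 0 := by
  induction l with
  | nil => exact hf
  | cons j l ih =>
    rw [List.foldr_cons]
    rcases eq_or_ne i j with rfl | hij
    · rw [ih, coordDiff_zero]
    · rw [coordDiff_comm hij, ih, coordDiff_zero]

theorem foldr_coordDiff_eq_zero {k : Fin d → ℕ} {h : Fin d → ℝ} {i : Fin d}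
    {f : (Fin d → ℝ) → ℝ} (hf : coordDiff i (k i) (h i) f = fun _ => 0) {l : List (Fin d)}
    (hi : i ∈ l) :
    l.foldr (fun i u => coordDiff i (k i) (h i) u) f = fun _ => 0 := by
  induction l with
  | nil => simp at hi
  | cons j l ih =>
    rw [List.foldr_cons]
    rcases List.mem_cons.1 hi with rfl | hi
    · exact coordDiff_foldr_eq_zero hf l
    · rw [ih hi, coordDiff_zero]

theorem mixedDiff_sub (k : Fin d → ℕ) (h : Fin d → ℝ) (f g : (Fin d → ℝ) → ℝ) :
    mixedDiff k h (fun x => f x - g x) = fun x => mixedDiff k h f x - mixedDiff k h g x :=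
  foldr_coordDiff_sub k h _ f g

theorem mixedDiff_restrictOrder_eval_eq_zero {r : Fin d → ℕ} {φ : MvPolynomial (Fin d) ℝ}
    (hφ : φ ∈ polys r) {e : Finset (Fin d)} (he : e.Nonempty) (h : Fin d → ℝ) :
    mixedDiff (restrictOrder r e) h (fun x => MvPolynomial.eval x φ) = fun _ => 0 := by
  obtain ⟨i, hi⟩ := he
  refine foldr_coordDiff_eq_zero (i := i) ?_ (List.mem_finRange i)
  rw [restrictOrder, if_pos hi]
  exact coordDiff_eval_eq_zero hφ i _

theorem foldr_coordDiff_singleton (r : Fin d → ℕ) (h : Fin d → ℝ) (i : Fin d)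
    (f : (Fin d → ℝ) → ℝ) (l : List (Fin d)) (hl : l.Nodup) :
    l.foldr (fun j u => coordDiff j (restrictOrder r {i} j) (h j) u) f =
      if i ∈ l then coordDiff i (r i) (h i) f else f := by
  induction l with
  | nil => simp
  | cons j l ih =>
    rw [List.foldr_cons, ih hl.of_cons]
    rcases eq_or_ne i j with rfl | hij
    · have : i ∉ l := (List.nodup_cons.1 hl).1
      simp [this, restrictOrder]
    · simp [hij, hij.symm, restrictOrder, coordDiff_zero_order]

theorem mixedDiff_restrictOrder_singleton (r : Fin d → ℕ) (h : Fin d → ℝ) (i : Fin d)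
    (f : (Fin d → ℝ) → ℝ) :
    mixedDiff (restrictOrder r {i}) h f = coordDiff i (r i) (h i) f := by
  rw [mixedDiff, foldr_coordDiff_singleton _ _ _ _ _ (List.nodup_finRange d),
    if_pos (List.mem_finRange i)]

/-! ### Norms under changes of variable -/

section Comparison

variable {α β : Type*} [MeasurableSpace α] [MeasurableSpace β]

theorem map_restrict_le {μ : Measure α} {ν : Measure β} {c : ℝ≥0∞} {T : α → β}
    (hT : Measurable T) (hmap : Measure.map T μ ≤ c • ν) {s : Set α} {s' : Set β}
    (hs' : MeasurableSet s') (hmaps : Set.MapsTo T s s') :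
    Measure.map T (μ.restrict s) ≤ c • ν.restrict s' :=
  calc Measure.map T (μ.restrict s) ≤ Measure.map T (μ.restrict (T ⁻¹' s')) :=
        Measure.map_mono (Measure.restrict_mono hmaps le_rfl) hT
    _ = (Measure.map T μ).restrict s' := (Measure.restrict_map hT hs').symm
    _ ≤ (c • ν).restrict s' := Measure.restrict_mono le_rfl hmap
    _ = c • ν.restrict s' := Measure.restrict_smul _ _ _

theorem aestronglyMeasurable_comp_of_map_le {μ : Measure α} {ν : Measure β} {c : ℝ≥0∞}
    {T : α → β} (hT : Measurable T) (hmap : Measure.map T μ ≤ c • ν) {f : β → ℝ}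
    (hf : AEStronglyMeasurable f ν) : AEStronglyMeasurable (f ∘ T) μ :=
  hf.comp_quasiMeasurePreserving ⟨hT, Measure.absolutelyContinuous_of_le_smul hmap⟩

/-- The common device for all substitutions below: a bound on the pushforward measure is a bound on
the composition operator. For `p = ∞` the exponent is 0 and the density plays no role. -/
theorem eLpNorm_comp_le_of_map_le {μ : Measure α} {ν : Measure β} {c : ℝ≥0∞}
    {T : α → β} (hT : Measurable T) (hmap : Measure.map T μ ≤ c • ν) (hc : c ≠ 0) {f : β → ℝ}
    (hf : AEStronglyMeasurable f ν) (p : ℝ≥0∞) :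
    eLpNorm (f ∘ T) p μ ≤ c ^ (1 / p).toReal * eLpNorm f p ν := by
  have hf' : AEStronglyMeasurable f (Measure.map T μ) :=
    hf.mono_ac (Measure.absolutelyContinuous_of_le_smul hmap)
  rw [← eLpNorm_map_measure hf' hT.aemeasurable, ← smul_eq_mul,
    ← eLpNorm_smul_measure_of_ne_zero hc]
  exact eLpNorm_mono_measure f hmap

/-- Removes the exponent from constants, making them uniform in `p`. -/
theorem rpow_one_div_toReal_le {c p : ℝ≥0∞} (hc : 1 ≤ c) (hp : 1 ≤ p) :
    c ^ (1 / p).toReal ≤ c := by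
  conv_rhs => rw [← ENNReal.rpow_one c]
  refine ENNReal.rpow_le_rpow_of_exponent_le hc ?_
  have : 1 / p ≤ 1 := by simpa using hp
  simpa using ENNReal.toReal_mono ENNReal.one_ne_top this

theorem lintegral_ofReal_abs_rpow (f : α → ℝ) {p : ℝ≥0∞} (hp : p ≠ 0) (hp' : p ≠ ∞)
    (μ : Measure α) :
    ∫⁻ x, ENNReal.ofReal (|f x| ^ p.toReal) ∂μ = eLpNorm f p μ ^ p.toReal := by
  have hpos : 0 < p.toReal := ENNReal.toReal_pos hp hp'
  rw [eLpNorm_eq_lintegral_rpow_enorm_toReal hp hp', ← ENNReal.rpow_mul,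
    one_div_mul_cancel hpos.ne', ENNReal.rpow_one]
  refine lintegral_congr fun x => ?_
  rw [← ENNReal.ofReal_rpow_of_nonneg (abs_nonneg _) hpos.le, ← Real.enorm_eq_ofReal_abs]

end Comparison

/-! ### Boxes, translations and bounds for differences -/

theorem box_eq_pi (a b : Fin d → ℝ) : box a b = Set.univ.pi fun i => Set.Icc (a i) (b i) := by
  ext x
  simp [box, Pi.le_def, forall_and]

theorem box_eq_Icc (a b : Fin d → ℝ) : box a b = Set.Icc a b := by
  rw [box_eq_pi, Set.pi_univ_Icc]

theorem measurableSet_box (a b : Fin d → ℝ) : MeasurableSet (box a b) := by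
  rw [box_eq_Icc]
  exact measurableSet_Icc

theorem measurableSet_shiftBox (a b y : Fin d → ℝ) : MeasurableSet (shiftBox a b y) := by
  have : shiftBox a b y = box a b ∩ (fun x => x + y) ⁻¹' box a b := by
    ext x
    simp [shiftBox, box]
  rw [this]
  exact (measurableSet_box a b).inter ((measurable_add_const y) (measurableSet_box a b))

theorem volume_stepSet {t : Fin d → ℝ} (ht : ∀ i, 0 < t i) :
    volume (stepSet t) = ENNReal.ofReal (2 ^ d * ∏ i, t i) := by
  have : stepSet t = Set.univ.pi fun i => Set.Icc (-t i) (t i) := by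
    ext x
    simp [stepSet, abs_le, Pi.le_def, forall_and]
  rw [this, volume_pi_pi]
  simp only [Real.volume_Icc]
  rw [← ENNReal.ofReal_prod_of_nonneg fun i _ => by linarith [ht i]]
  congr 1
  calc ∏ i, (t i - -t i) = ∏ i, 2 * t i := Finset.prod_congr rfl fun i _ => by ring
    _ = _ := by simp [Finset.prod_mul_distrib]

theorem map_update_add (i : Fin d) (c : ℝ) :
    Measure.map (fun x : Fin d → ℝ => Function.update x i (x i + c)) volume = volume := by
  have : (fun x : Fin d → ℝ => Function.update x i (x i + c)) = fun x => x + Pi.single i c := by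
    funext x j
    rcases eq_or_ne j i with rfl | h
    · simp
    · simp [h]
  rw [this, map_add_right_eq_self]

theorem measurable_update_add (i : Fin d) (c : ℝ) :
    Measurable fun x : Fin d → ℝ => Function.update x i (x i + c) := by
  refine measurable_pi_lambda _ fun j => ?_
  rcases eq_or_ne j i with rfl | h
  · simpa using (measurable_pi_apply (X := fun _ : Fin d => ℝ) j).add_const c
  · simpa [h] using measurable_pi_apply j

theorem map_update_add_restrict_le {i : Fin d} {c : ℝ} {s s' : Set (Fin d → ℝ)}
    (hs' : MeasurableSet s')
    (hmaps : Set.MapsTo (fun x : Fin d → ℝ => Function.update x i (x i + c)) s s') :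
    Measure.map (fun x : Fin d → ℝ => Function.update x i (x i + c)) (volume.restrict s) ≤
      (1 : ℝ≥0∞) • volume.restrict s' :=
  map_restrict_le (measurable_update_add i c) (by rw [one_smul, map_update_add]) hs' hmaps

theorem coordDiff_ae_eq {i : Fin d} {k : ℕ} {η : ℝ} {s s' : Set (Fin d → ℝ)}
    (hs' : MeasurableSet s')
    (hmaps : ∀ j ≤ k, Set.MapsTo
      (fun x : Fin d → ℝ => Function.update x i (x i + (j : ℝ) * η)) s s')
    {f g : (Fin d → ℝ) → ℝ} (h : f =ᵐ[volume.restrict s'] g) :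
    coordDiff i k η f =ᵐ[volume.restrict s] coordDiff i k η g := by
  have : ∀ j ∈ Finset.range (k + 1), ∀ᵐ x ∂volume.restrict s,
      f (Function.update x i (x i + (j : ℝ) * η)) =
        g (Function.update x i (x i + (j : ℝ) * η)) := by
    intro j hj
    have hj' := map_update_add_restrict_le hs' (hmaps j (Finset.mem_range_succ_iff.1 hj))
    exact (Measure.QuasiMeasurePreserving.mk (measurable_update_add i _)
      (Measure.absolutelyContinuous_of_le_smul hj')).ae h
  filter_upwards [(Finset.eventually_all _).2 this] with x hx
  exact Finset.sum_congr rfl fun j hj => by rw [hx j hj]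

theorem eLpNorm_coordDiff_le {i : Fin d} {k : ℕ} {η : ℝ} {s s' : Set (Fin d → ℝ)}
    (hs' : MeasurableSet s')
    (hmaps : ∀ j ≤ k, Set.MapsTo
      (fun x : Fin d → ℝ => Function.update x i (x i + (j : ℝ) * η)) s s')
    {f : (Fin d → ℝ) → ℝ} (hf : AEStronglyMeasurable f (volume.restrict s')) {p : ℝ≥0∞}
    (hp : 1 ≤ p) :
    AEStronglyMeasurable (coordDiff i k η f) (volume.restrict s) ∧
      eLpNorm (coordDiff i k η f) p (volume.restrict s) ≤
        2 ^ k * eLpNorm f p (volume.restrict s') := by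
  have hle : ∀ j ∈ Finset.range (k + 1), _ := fun j hj =>
    map_update_add_restrict_le hs' (hmaps j (Finset.mem_range_succ_iff.1 hj))
  have hsum : coordDiff i k η f = ∑ j ∈ Finset.range (k + 1),
      ((-1 : ℝ) ^ (k - j) * (k.choose j : ℝ)) •
        (f ∘ fun x : Fin d → ℝ => Function.update x i (x i + (j : ℝ) * η)) := by
    funext x
    simp [coordDiff, Finset.sum_apply]
  have hmeas : ∀ j ∈ Finset.range (k + 1), AEStronglyMeasurable
      (((-1 : ℝ) ^ (k - j) * (k.choose j : ℝ)) •
        (f ∘ fun x : Fin d → ℝ => Function.update x i (x i + (j : ℝ) * η)))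
      (volume.restrict s) := fun j hj =>
    (aestronglyMeasurable_comp_of_map_le (measurable_update_add i _) (hle j hj) hf).const_smul _
  rw [hsum]
  refine ⟨Finset.aestronglyMeasurable_sum _ hmeas, (eLpNorm_sum_le hmeas hp).trans ?_⟩
  calc _ ≤ ∑ j ∈ Finset.range (k + 1), (k.choose j : ℝ≥0∞) *
        eLpNorm f p (volume.restrict s') := by
        refine Finset.sum_le_sum fun j hj => ?_
        rw [eLpNorm_const_smul]
        refine mul_le_mul' ?_ ?_
        · rw [enorm_mul]
          simp [enorm_pow, Real.enorm_natCast]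
        · simpa using eLpNorm_comp_le_of_map_le (measurable_update_add i _) (hle j hj)
            one_ne_zero hf p
    _ = _ := by
        rw [← Finset.sum_mul]
        congr 1
        exact_mod_cast Nat.sum_range_choose k

/-- The part of the displacement `y` that involves only the coordinates in `l`. -/
def listShift (l : List (Fin d)) (y : Fin d → ℝ) : Fin d → ℝ :=
  fun i => if i ∈ l then y i else 0

/-- The points used by the difference in direction `i` lie between `x i` and `x i + k i * h i`, both
in the interval. As `i ∉ l`, the remaining displacement ignores this coordinate, which allows
induction on the list of coordinates. -/
theorem mapsTo_shiftBox_cons {a b : Fin d → ℝ} {k : Fin d → ℕ} {h : Fin d → ℝ} {i : Fin d}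
    {l : List (Fin d)} (hi : i ∉ l) {j : ℕ} (hj : j ≤ k i) :
    Set.MapsTo (fun x : Fin d → ℝ => Function.update x i (x i + (j : ℝ) * h i))
      (shiftBox a b (listShift (i :: l) fun i => (k i : ℝ) * h i))
      (shiftBox a b (listShift l fun i => (k i : ℝ) * h i)) := by
  rintro x ⟨hx, hxy⟩
  have key : x i + (j : ℝ) * h i ∈ Set.Icc (a i) (b i) := by
    have h1 := hx i
    have h2 := hxy i
    simp only [listShift, List.mem_cons, true_or, if_true] at h2
    have hj' : (j : ℝ) ≤ k i := by exact_mod_cast hj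
    have hj0 : (0 : ℝ) ≤ j := j.cast_nonneg
    rcases le_total 0 (h i) with hh | hh
    · exact ⟨by nlinarith [h1.1], by nlinarith [h2.2, mul_le_mul_of_nonneg_right hj' hh]⟩
    · exact ⟨by nlinarith [h2.1, mul_le_mul_of_nonpos_right hj' hh], by nlinarith [h1.2]⟩
  refine ⟨fun m => ?_, fun m => ?_⟩
  · rcases eq_or_ne m i with rfl | hm
    · simpa using key
    · simpa [hm] using hx m
  · rcases eq_or_ne m i with rfl | hm
    · simpa [listShift, hi] using key
    · simpa [listShift, hm] using hxy m

theorem foldr_coordDiff_ae_eq {a b : Fin d → ℝ} (k : Fin d → ℕ) (h : Fin d → ℝ)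
    {f g : (Fin d → ℝ) → ℝ} (hfg : f =ᵐ[volume.restrict (box a b)] g) (l : List (Fin d))
    (hl : l.Nodup) :
    l.foldr (fun i u => coordDiff i (k i) (h i) u) f
      =ᵐ[volume.restrict (shiftBox a b (listShift l fun i => (k i : ℝ) * h i))]
    l.foldr (fun i u => coordDiff i (k i) (h i) u) g := by
  induction l with
  | nil =>
    have : shiftBox a b (listShift [] fun i => (k i : ℝ) * h i) = box a b := by
      ext x
      simp [shiftBox, listShift, box]
    simpa [this] using hfg
  | cons i l ih =>
    exact coordDiff_ae_eq (measurableSet_shiftBox _ _ _)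
      (fun j hj => mapsTo_shiftBox_cons (List.nodup_cons.1 hl).1 hj) (ih hl.of_cons)

theorem eLpNorm_foldr_coordDiff_le {a b : Fin d → ℝ} (k : Fin d → ℕ) (h : Fin d → ℝ)
    {f : (Fin d → ℝ) → ℝ} (hf : AEStronglyMeasurable f (volume.restrict (box a b)))
    {p : ℝ≥0∞} (hp : 1 ≤ p) (l : List (Fin d)) (hl : l.Nodup) :
    AEStronglyMeasurable (l.foldr (fun i u => coordDiff i (k i) (h i) u) f)
      (volume.restrict (shiftBox a b (listShift l fun i => (k i : ℝ) * h i))) ∧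
    eLpNorm (l.foldr (fun i u => coordDiff i (k i) (h i) u) f) p
      (volume.restrict (shiftBox a b (listShift l fun i => (k i : ℝ) * h i))) ≤
      2 ^ (l.map k).sum * eLpNorm f p (volume.restrict (box a b)) := by
  induction l with
  | nil =>
    have : shiftBox a b (listShift [] fun i => (k i : ℝ) * h i) = box a b := by
      ext x
      simp [shiftBox, listShift, box]
    simpa [this] using hf
  | cons i l ih =>
    obtain ⟨ih1, ih2⟩ := ih hl.of_cons
    obtain ⟨h1, h2⟩ := eLpNorm_coordDiff_le (η := h i) (measurableSet_shiftBox _ _ _)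
      (fun j hj => mapsTo_shiftBox_cons (k := k) (a := a) (b := b) (h := h)
        (List.nodup_cons.1 hl).1 hj) ih1 hp
    refine ⟨h1, h2.trans ?_⟩
    rw [List.map_cons, List.sum_cons, pow_add, mul_assoc]
    exact mul_le_mul_right ih2 _

theorem listShift_finRange (y : Fin d → ℝ) : listShift (List.finRange d) y = y := by
  funext i
  simp [listShift]

theorem mixedDiff_ae_eq {a b : Fin d → ℝ} (k : Fin d → ℕ) (h : Fin d → ℝ)
    {f g : (Fin d → ℝ) → ℝ} (hfg : f =ᵐ[volume.restrict (box a b)] g) :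
    mixedDiff k h f =ᵐ[volume.restrict (shiftBox a b fun i => (k i : ℝ) * h i)]
      mixedDiff k h g := by
  have := foldr_coordDiff_ae_eq k h hfg _ (List.nodup_finRange d)
  rwa [listShift_finRange] at this

theorem eLpNorm_mixedDiff_le {a b : Fin d → ℝ} (k : Fin d → ℕ) (h : Fin d → ℝ)
    {f : (Fin d → ℝ) → ℝ} (hf : AEStronglyMeasurable f (volume.restrict (box a b)))
    {p : ℝ≥0∞} (hp : 1 ≤ p) :
    eLpNorm (mixedDiff k h f) p (volume.restrict (shiftBox a b fun i => (k i : ℝ) * h i)) ≤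
      2 ^ (∑ i, k i) * eLpNorm f p (volume.restrict (box a b)) := by
  have := (eLpNorm_foldr_coordDiff_le (a := a) (b := b) k h hf hp _ (List.nodup_finRange d)).2
  rwa [listShift_finRange, ← List.ofFn_eq_map, List.sum_ofFn] at this

/-! ### The mean modulus and the lower estimate -/

theorem meanModulus_congr_ae {a b : Fin d → ℝ} (k : Fin d → ℕ) (p : ℝ≥0∞)
    {f g : (Fin d → ℝ) → ℝ} (hfg : f =ᵐ[volume.restrict (box a b)] g) (t : Fin d → ℝ) :
    meanModulus k p a b f t = meanModulus k p a b g t := by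
  unfold meanModulus
  split_ifs with hp
  · exact iSup_congr fun h => iSup_congr fun _ => eLpNorm_congr_ae (mixedDiff_ae_eq k h hfg)
  · congr 2
    refine lintegral_congr fun h => lintegral_congr_ae ?_
    filter_upwards [mixedDiff_ae_eq k h hfg] with x hx
    rw [hx]

/-- A bound on all differences on their domains bounds the `p`-mean modulus at the full step. -/
theorem meanModulus_le_of_forall {a b : Fin d → ℝ} {k : Fin d → ℕ} {p : ℝ≥0∞} (hp : 1 ≤ p)
    {f : (Fin d → ℝ) → ℝ} {t : Fin d → ℝ} (ht : ∀ i, 0 < t i) {N : ℝ≥0∞}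
    (hN : ∀ h, eLpNorm (mixedDiff k h f) p
      (volume.restrict (shiftBox a b fun i => (k i : ℝ) * h i)) ≤ N) :
    meanModulus k p a b f t ≤ 2 ^ d * N := by
  unfold meanModulus
  split_ifs with hp'
  · subst hp'
    refine (iSup₂_le fun h _ => hN h).trans ?_
    exact le_mul_of_one_le_left' (one_le_pow₀ one_le_two)
  · have hp0 : p ≠ 0 := (zero_lt_one.trans_le hp).ne'
    have hpos : 0 < p.toReal := ENNReal.toReal_pos hp0 hp'
    have hprod : 0 < ∏ i, t i := Finset.prod_pos fun i _ => ht i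
    calc _ ≤ (ENNReal.ofReal (∏ i, (t i)⁻¹) * ∫⁻ _ in stepSet t, N ^ p.toReal)
          ^ (1 / p.toReal) := by
          refine ENNReal.rpow_le_rpow (mul_le_mul_right (lintegral_mono fun h => ?_) _)
            (by positivity)
          simp only
          rw [lintegral_ofReal_abs_rpow _ hp0 hp']
          exact ENNReal.rpow_le_rpow (hN h) hpos.le
      -- The set of steps has volume `2 ^ d * ∏ t i`, of which the normalization removes all but `2
      -- ^ d`.
      _ = (2 ^ d * N ^ p.toReal) ^ (1 / p.toReal) := by
          congr 1
          rw [lintegral_const, Measure.restrict_apply_univ, volume_stepSet ht,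
            mul_comm (N ^ _), ← mul_assoc, ← ENNReal.ofReal_mul
              (Finset.prod_nonneg fun i _ => (inv_pos.2 (ht i)).le), Finset.prod_inv_distrib]
          congr 1
          rw [mul_comm, mul_assoc, mul_inv_cancel₀ hprod.ne', mul_one,
            ENNReal.ofReal_pow zero_le_two]
          simp
      _ = (2 ^ d : ℝ≥0∞) ^ (1 / p).toReal * N := by
          rw [ENNReal.mul_rpow_of_nonneg _ _ (by positivity), ← ENNReal.rpow_mul,
            mul_one_div_cancel hpos.ne', ENNReal.rpow_one]
          simp
      _ ≤ 2 ^ d * N := mul_le_mul_left (rpow_one_div_toReal_le (one_le_pow₀ one_le_two) hp) _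

theorem measurable_eval (φ : MvPolynomial (Fin d) ℝ) :
    Measurable fun x : Fin d → ℝ => MvPolynomial.eval x φ :=
  (MvPolynomial.continuous_eval φ).measurable

theorem meanModulus_le_bestError (r : Fin d → ℕ) {p : ℝ≥0∞} (hp : 1 ≤ p) {a b : Fin d → ℝ}
    (hab : ∀ i, a i < b i) {f : (Fin d → ℝ) → ℝ}
    (hf : AEStronglyMeasurable f (volume.restrict (box a b))) {e : Finset (Fin d)}
    (he : e.Nonempty) :
    meanModulus (restrictOrder r e) p a b f (fun i => b i - a i) ≤
      2 ^ d * 2 ^ (∑ i, r i) * bestError r p a b f := by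
  simp only [bestError, ENNReal.mul_iInf_of_ne (a := (2 ^ d * 2 ^ (∑ i, r i) : ℝ≥0∞))
    (by positivity) (ENNReal.mul_ne_top (by simp) (by simp))]
  refine le_iInf₂ fun φ hφ => ?_
  rw [mul_assoc]
  refine meanModulus_le_of_forall hp (fun i => sub_pos.2 (hab i)) fun h => ?_
  -- The polynomial can be subtracted for free because `e` is nonempty.
  have hdiff : mixedDiff (restrictOrder r e) h f =
      mixedDiff (restrictOrder r e) h fun x => f x - MvPolynomial.eval x φ := by
    rw [mixedDiff_sub, mixedDiff_restrictOrder_eval_eq_zero hφ he]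
    simp
  rw [hdiff]
  refine (eLpNorm_mixedDiff_le _ h (hf.sub (measurable_eval φ).aestronglyMeasurable) hp).trans ?_
  refine mul_le_mul_left (pow_le_pow_right₀ one_le_two (Finset.sum_le_sum fun i _ => ?_)) _
  unfold restrictOrder
  split_ifs <;> simp

theorem totalMeanModulus_le_bestError (r : Fin d → ℕ) {p : ℝ≥0∞} (hp : 1 ≤ p)
    {a b : Fin d → ℝ} (hab : ∀ i, a i < b i) {f : (Fin d → ℝ) → ℝ}
    (hf : AEStronglyMeasurable f (volume.restrict (box a b))) :
    totalMeanModulus r p a b f (fun i => b i - a i) ≤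
      2 ^ d * (2 ^ d * 2 ^ (∑ i, r i)) * bestError r p a b f := by
  unfold totalMeanModulus
  refine (Finset.sum_le_card_nsmul _ _ _ fun e he =>
    meanModulus_le_bestError r hp hab hf (Finset.mem_filter.1 he).2).trans ?_
  rw [nsmul_eq_mul, mul_assoc (2 ^ d : ℝ≥0∞) (2 ^ d * 2 ^ (∑ i, r i))]
  refine mul_le_mul' ?_ le_rfl
  have : (Finset.univ.filter fun e : Finset (Fin d) => e.Nonempty).card ≤ 2 ^ d := by
    refine (Finset.card_le_univ _).trans ?_
    simp
  exact_mod_cast this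

/-! ### Changes of variable on pairs of points -/

theorem map_diagonal_affine {α : Fin d → ℝ} (hα : ∀ i, α i ≠ 0) (β : Fin d → ℝ) :
    Measure.map (fun x i => α i * x i + β i) (volume : Measure (Fin d → ℝ)) =
      ENNReal.ofReal |(∏ i, α i)⁻¹| • volume := by
  have hdet : LinearMap.det (Matrix.toLin' (Matrix.diagonal α)) = ∏ i, α i := by
    rw [LinearMap.det_toLin', Matrix.det_diagonal]
  have h := Measure.map_linearMap_addHaar_eq_smul_addHaar (volume : Measure (Fin d → ℝ))
    (f := Matrix.toLin' (Matrix.diagonal α))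
    (by rw [hdet]; exact Finset.prod_ne_zero_iff.2 fun i _ => hα i)
  rw [hdet] at h
  have hcomp : (fun (x : Fin d → ℝ) i => α i * x i + β i) =
      (fun x => x + β) ∘ Matrix.toLin' (Matrix.diagonal α) := by
    funext x i
    simp [Matrix.mulVec_diagonal]
  rw [hcomp, ← Measure.map_map (measurable_add_const β)
    (LinearMap.continuous_of_finiteDimensional _).measurable, h, Measure.map_smul,
    map_add_right_eq_self]

/-- Tonelli on fibres: a map that fixes the first point scales the product measure by the factor by
which it scales each fibre. -/
theorem map_prod_fiberwise {g : (Fin d → ℝ) → (Fin d → ℝ) → (Fin d → ℝ)} {c : ℝ≥0∞}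
    (hg : Measurable (Function.uncurry g))
    (hmap : ∀ x, Measure.map (g x) volume = c • (volume : Measure (Fin d → ℝ))) :
    Measure.map (fun w : (Fin d → ℝ) × (Fin d → ℝ) => (w.1, g w.1 w.2))
      (volume.prod volume) = c • (volume : Measure (Fin d → ℝ)).prod volume := by
  have hm : Measurable fun w : (Fin d → ℝ) × (Fin d → ℝ) => (w.1, g w.1 w.2) :=
    measurable_fst.prodMk hg
  ext s hs
  rw [Measure.map_apply hm hs, Measure.prod_apply (hm hs), Measure.smul_apply, smul_eq_mul,
    Measure.prod_apply hs, ← lintegral_const_mul _ (measurable_measure_prodMk_left hs)]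
  refine lintegral_congr fun x => ?_
  have hgx : Measurable (g x) := hg.comp measurable_prodMk_left
  rw [← smul_eq_mul, ← Measure.smul_apply, ← hmap x,
    Measure.map_apply hgx (measurable_prodMk_left hs)]
  rfl

/-- Exchange of the `k`-th coordinates of a pair of points, as a linear map. -/
def swapCoord (k : Fin d) :
    (Fin d → ℝ) × (Fin d → ℝ) →ₗ[ℝ] (Fin d → ℝ) × (Fin d → ℝ) where
  toFun w := (Function.update w.1 k (w.2 k), Function.update w.2 k (w.1 k))
  map_add' v w := by
    ext i <;> rcases eq_or_ne i k with rfl | h <;> simp [*]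
  map_smul' c w := by
    ext i <;> rcases eq_or_ne i k with rfl | h <;> simp [*]

/-- The map is a linear involution, so its determinant has absolute value 1. -/
theorem map_swapCoord (k : Fin d) :
    Measure.map (swapCoord k) (volume.prod volume) =
      (volume : Measure (Fin d → ℝ)).prod volume := by
  have hinv : swapCoord k ∘ₗ swapCoord k = LinearMap.id := by
    refine LinearMap.ext fun w => ?_
    simp [swapCoord]
  have hdet : LinearMap.det (swapCoord k) * LinearMap.det (swapCoord k) = 1 := by
    rw [← LinearMap.det_comp, hinv, LinearMap.det_id]
  have habs : |LinearMap.det (swapCoord k)| = 1 := by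
    rwa [← abs_mul_abs_self, mul_self_eq_one_iff, or_iff_left
      (by linarith [abs_nonneg (LinearMap.det (swapCoord k))])] at hdet
  have : ((volume : Measure (Fin d → ℝ)).prod (volume : Measure (Fin d → ℝ))).IsAddHaarMeasure :=
    Measure.prod.instIsAddHaarMeasure _ _
  rw [Measure.map_linearMap_addHaar_eq_smul_addHaar _ (left_ne_zero_of_mul_eq_one hdet), abs_inv,
    habs]
  simp

/-- In the `k`-th coordinate, replace `(x, z)` by `((1 - s) x + s z, x)`. -/
def mixCoord (k : Fin d) (s : ℝ) (w : (Fin d → ℝ) × (Fin d → ℝ)) :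
    (Fin d → ℝ) × (Fin d → ℝ) :=
  (Function.update w.1 k ((1 - s) * w.1 k + s * w.2 k), Function.update w.2 k (w.1 k))

theorem measurable_update_of {α : Type*} [MeasurableSpace α] {f : α → Fin d → ℝ} {g : α → ℝ}
    (hf : Measurable f) (hg : Measurable g) (k : Fin d) :
    Measurable fun w => Function.update (f w) k (g w) := by
  refine measurable_pi_lambda _ fun j => ?_
  rcases eq_or_ne j k with rfl | h
  · simpa using hg
  · simpa [h, Function.comp_def] using (measurable_pi_apply j).comp hf

theorem measurable_mixCoord (k : Fin d) (s : ℝ) : Measurable (mixCoord k s) := by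
  refine (measurable_update_of measurable_fst ?_ k).prodMk
    (measurable_update_of measurable_snd ?_ k)
  all_goals fun_prop

/-- In the plane of the two `k`-th coordinates the Jacobian has absolute value `s`. Storing `x k`
rather than `z k` in the second point is what keeps the map invertible at `s = 1`; with `z k` the
Jacobian would be `1 - s`. -/
theorem map_mixCoord (k : Fin d) {s : ℝ} (hs : 0 < s) :
    Measure.map (mixCoord k s) (volume.prod volume) =
      ENNReal.ofReal s⁻¹ • (volume : Measure (Fin d → ℝ)).prod volume := by
  let g : (Fin d → ℝ) → (Fin d → ℝ) → (Fin d → ℝ) :=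
    fun x z => Function.update z k ((1 - s) * x k + s * z k)
  have hg : Measurable (Function.uncurry g) :=
    measurable_update_of measurable_snd (by fun_prop) k
  have hcomp : mixCoord k s =
      swapCoord k ∘ fun w : (Fin d → ℝ) × (Fin d → ℝ) => (w.1, g w.1 w.2) := by
    funext w
    ext i <;> rcases eq_or_ne i k with rfl | h <;> simp [mixCoord, swapCoord, g, *]
  have hm : Measurable (swapCoord k) := by
    refine (measurable_update_of measurable_fst ?_ k).prodMk
      (measurable_update_of measurable_snd ?_ k)
    all_goals fun_prop
  have hmap : ∀ x, Measure.map (g x) volume =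
      ENNReal.ofReal s⁻¹ • (volume : Measure (Fin d → ℝ)) := by
    intro x
    have hα : ∀ i, Function.update (fun _ : Fin d => (1 : ℝ)) k s i ≠ 0 := by
      intro i
      rcases eq_or_ne i k with rfl | h <;> simp [*, hs.ne']
    have h := map_diagonal_affine hα (Function.update (fun _ => 0) k ((1 - s) * x k))
    have heq : (fun (z : Fin d → ℝ) i => Function.update (fun _ : Fin d => (1 : ℝ)) k s i * z i +
        Function.update (fun _ : Fin d => (0 : ℝ)) k ((1 - s) * x k) i) = g x := by
      funext z i
      rcases eq_or_ne i k with rfl | h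
      · simp [g]; ring
      · simp [g, h]
    rw [heq, Finset.prod_update_of_mem (Finset.mem_univ k)] at h
    simpa [abs_of_pos hs] using h
  have hm' : Measurable fun w : (Fin d → ℝ) × (Fin d → ℝ) => (w.1, g w.1 w.2) :=
    measurable_fst.prodMk hg
  rw [hcomp, ← Measure.map_map hm hm', map_prod_fiberwise hg hmap, Measure.map_smul, map_swapCoord]

/-! ### Averages and deviations on the unit cube -/

/-- The unit cube. -/
abbrev cube (d : ℕ) : Set (Fin d → ℝ) := box 0 1

/-- Lebesgue measure on the unit cube. -/
noncomputable abbrev cubeMeasure (d : ℕ) : Measure (Fin d → ℝ) := volume.restrict (cube d)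

instance : IsProbabilityMeasure (cubeMeasure d) := by
  constructor
  rw [Measure.restrict_apply_univ, cube, box_eq_pi, volume_pi_pi]
  simp

/-- Lebesgue measure on the pairs of points of the unit cube. -/
noncomputable abbrev pairMeasure (d : ℕ) : Measure ((Fin d → ℝ) × (Fin d → ℝ)) :=
  (cubeMeasure d).prod (cubeMeasure d)

theorem mixCoord_mem {k : Fin d} {s : ℝ} (hs : 0 ≤ s) (hs' : s ≤ 1)
    {w : (Fin d → ℝ) × (Fin d → ℝ)} (hw : w ∈ cube d ×ˢ cube d) :
    mixCoord k s w ∈ cube d ×ˢ cube d := by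
  obtain ⟨h1, h2⟩ := hw
  refine ⟨fun i => ?_, fun i => ?_⟩
  · have h1' := h1 i
    have h2' := h2 i
    simp only [Pi.zero_apply, Pi.one_apply, Set.mem_Icc] at h1' h2'
    rcases eq_or_ne i k with rfl | h
    · simp only [mixCoord, Function.update_self, Pi.zero_apply, Pi.one_apply, Set.mem_Icc]
      constructor <;> nlinarith
    · simpa [mixCoord, h] using h1'
  · rcases eq_or_ne i k with rfl | h
    · simpa [mixCoord] using h1 i
    · simpa [mixCoord, h] using h2 i

theorem map_mixCoord_pairMeasure_le (k : Fin d) {s : ℝ} (hs : 0 < s) (hs' : s ≤ 1) :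
    Measure.map (mixCoord k s) (pairMeasure d) ≤ ENNReal.ofReal s⁻¹ • pairMeasure d := by
  rw [pairMeasure, Measure.prod_restrict]
  exact map_restrict_le (measurable_mixCoord k s) (map_mixCoord k hs).le
    ((measurableSet_box _ _).prod (measurableSet_box _ _)) fun w hw => mixCoord_mem hs.le hs' hw

/-- The combination of `H` at the mixed points that reproduces `H (x, z)` when `H` is a polynomial
of degree less than `m` in the `k`-th coordinate of `x` and independent of that of `z`. -/
noncomputable def avgCoord (k : Fin d) (m : ℕ) (H : (Fin d → ℝ) × (Fin d → ℝ) → ℝ) :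
    (Fin d → ℝ) × (Fin d → ℝ) → ℝ :=
  fun w => ∑ j ∈ Finset.range m,
    (-1 : ℝ) ^ j * (m.choose (j + 1) : ℝ) * H (mixCoord k (((j + 1 : ℕ) : ℝ) / m) w)

theorem avgCoord_sub (k : Fin d) (m : ℕ) (H H' : (Fin d → ℝ) × (Fin d → ℝ) → ℝ) :
    avgCoord k m (fun w => H w - H' w) = fun w => avgCoord k m H w - avgCoord k m H' w := by
  funext w
  simp only [avgCoord, mul_sub, Finset.sum_sub_distrib]

theorem avgCoord_smul (k : Fin d) (m : ℕ) (c : ℝ) (H : (Fin d → ℝ) × (Fin d → ℝ) → ℝ) :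
    avgCoord k m (fun w => c * H w) = fun w => c * avgCoord k m H w := by
  funext w
  simp only [avgCoord, Finset.mul_sum]
  exact Finset.sum_congr rfl fun j _ => by ring

theorem eLpNorm_avgCoord_le (k : Fin d) {m : ℕ} (hm : 1 ≤ m)
    {H : (Fin d → ℝ) × (Fin d → ℝ) → ℝ} (hH : AEStronglyMeasurable H (pairMeasure d))
    {p : ℝ≥0∞} (hp : 1 ≤ p) :
    AEStronglyMeasurable (avgCoord k m H) (pairMeasure d) ∧
      eLpNorm (avgCoord k m H) p (pairMeasure d) ≤
        (2 ^ m * m) * eLpNorm H p (pairMeasure d) := by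
  have hm0 : (0 : ℝ) < m := by exact_mod_cast hm
  have hpos : ∀ j : ℕ, 0 < ((j + 1 : ℕ) : ℝ) / m := fun j => by positivity
  have hle1 : ∀ j ∈ Finset.range m, ((j + 1 : ℕ) : ℝ) / m ≤ 1 := fun j hj => by
    rw [div_le_one hm0]
    exact_mod_cast Finset.mem_range.1 hj
  have hle : ∀ j ∈ Finset.range m, _ := fun j hj =>
    map_mixCoord_pairMeasure_le k (hpos j) (hle1 j hj)
  have hsum : avgCoord k m H = ∑ j ∈ Finset.range m,
      ((-1 : ℝ) ^ j * (m.choose (j + 1) : ℝ)) • (H ∘ mixCoord k (((j + 1 : ℕ) : ℝ) / m)) := by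
    funext w
    simp [avgCoord, Finset.sum_apply]
  have hmeas : ∀ j ∈ Finset.range m, AEStronglyMeasurable
      (((-1 : ℝ) ^ j * (m.choose (j + 1) : ℝ)) • (H ∘ mixCoord k (((j + 1 : ℕ) : ℝ) / m)))
      (pairMeasure d) := fun j hj =>
    (aestronglyMeasurable_comp_of_map_le (measurable_mixCoord k _) (hle j hj) hH).const_smul _
  rw [hsum]
  refine ⟨Finset.aestronglyMeasurable_sum _ hmeas, (eLpNorm_sum_le hmeas hp).trans ?_⟩
  calc _ ≤ ∑ j ∈ Finset.range m, (m.choose (j + 1) : ℝ≥0∞) *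
        (m * eLpNorm H p (pairMeasure d)) := by
        refine Finset.sum_le_sum fun j hj => ?_
        rw [eLpNorm_const_smul]
        refine mul_le_mul' ?_ ?_
        · rw [enorm_mul]
          simp [enorm_pow, Real.enorm_natCast]
        -- The mixing parameter is `s = (j + 1) / m`, so the density `s⁻¹ = m / (j + 1)` lies
        -- between 1 and `m`.
        · have hinv : (1 : ℝ) ≤ (((j + 1 : ℕ) : ℝ) / m)⁻¹ := (one_le_inv₀ (hpos j)).2 (hle1 j hj)
          have h1 : (1 : ℝ≥0∞) ≤ ENNReal.ofReal (((j + 1 : ℕ) : ℝ) / m)⁻¹ :=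
            ENNReal.one_le_ofReal.2 hinv
          refine (eLpNorm_comp_le_of_map_le (measurable_mixCoord k _) (hle j hj)
            (zero_lt_one.trans_le h1).ne' hH p).trans (mul_le_mul' ?_ le_rfl)
          refine (rpow_one_div_toReal_le h1 hp).trans ?_
          rw [inv_div, ← ENNReal.ofReal_natCast]
          refine ENNReal.ofReal_le_ofReal (div_le_self hm0.le ?_)
          exact_mod_cast Nat.le_add_left 1 j
    _ ≤ _ := by
        rw [← Finset.sum_mul, ← mul_assoc]
        refine mul_le_mul' (mul_le_mul' ?_ le_rfl) le_rfl
        have h := Nat.sum_range_choose m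
        rw [Finset.sum_range_succ'] at h
        have h' : ∑ j ∈ Finset.range m, m.choose (j + 1) ≤ 2 ^ m := by omega
        exact_mod_cast h'

/-- The deviation of `f (x)` from its reproducing combination along the `k`-th coordinate. -/
noncomputable def devCoord (k : Fin d) (m : ℕ) (f : (Fin d → ℝ) → ℝ) :
    (Fin d → ℝ) × (Fin d → ℝ) → ℝ :=
  fun w => f w.1 - avgCoord k m (fun v => f v.1) w

/-- With step `(z k - x k) / m` the `j`-th node is the convex combination of `x k` and `z k` with
parameter `j / m`. The term `j = 0` is `f x`, and the others form the average. -/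
theorem coordDiff_eq_devCoord (k : Fin d) {m : ℕ} (hm : 1 ≤ m) (f : (Fin d → ℝ) → ℝ)
    (w : (Fin d → ℝ) × (Fin d → ℝ)) :
    coordDiff k m ((w.2 k - w.1 k) / m) f w.1 = (-1) ^ m * devCoord k m f w := by
  have hm0 : (m : ℝ) ≠ 0 := by positivity
  rw [coordDiff, Finset.sum_range_succ', devCoord, avgCoord, mul_sub, Finset.mul_sum,
    sub_eq_add_neg ((-1) ^ m * f w.1), add_comm, ← Finset.sum_neg_distrib]
  congr 1
  · simp
  · refine Finset.sum_congr rfl fun j hj => ?_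
    have hj' : j + 1 ≤ m := Finset.mem_range.1 hj
    have hsign : (-1 : ℝ) ^ (m - (j + 1)) = -((-1) ^ m * (-1) ^ j) := by
      obtain ⟨n, rfl⟩ := Nat.exists_eq_add_of_le hj'
      have h1 : ((-1 : ℝ) ^ j) * (-1) ^ j = 1 := by
        rw [← pow_add, Even.neg_one_pow ⟨j, rfl⟩]
      rw [Nat.add_sub_cancel_left, pow_add, pow_succ]
      linear_combination (-(-1 : ℝ) ^ n) * h1
    have hpt : w.1 k + ((j + 1 : ℕ) : ℝ) * ((w.2 k - w.1 k) / m) =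
        (1 - ((j + 1 : ℕ) : ℝ) / m) * w.1 k + ((j + 1 : ℕ) : ℝ) / m * w.2 k := by
      field_simp
      ring
    rw [hsign, hpt, mixCoord]
    ring

theorem map_fst_pairMeasure : Measure.map Prod.fst (pairMeasure d) = cubeMeasure d := by
  simp [pairMeasure]

theorem eLpNorm_comp_fst {f : (Fin d → ℝ) → ℝ} (hf : AEStronglyMeasurable f (cubeMeasure d))
    (p : ℝ≥0∞) :
    eLpNorm (fun w : (Fin d → ℝ) × (Fin d → ℝ) => f w.1) p (pairMeasure d) =
      eLpNorm f p (cubeMeasure d) :=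
  eLpNorm_comp_measurePreserving hf ⟨measurable_fst, map_fst_pairMeasure⟩

theorem eLpNorm_devCoord_le (k : Fin d) {m : ℕ} (hm : 1 ≤ m) {f : (Fin d → ℝ) → ℝ}
    (hf : AEStronglyMeasurable f (cubeMeasure d)) {p : ℝ≥0∞} (hp : 1 ≤ p) :
    AEStronglyMeasurable (devCoord k m f) (pairMeasure d) ∧
      eLpNorm (devCoord k m f) p (pairMeasure d) ≤
        (1 + 2 ^ m * m) * eLpNorm f p (cubeMeasure d) := by
  have hf' : AEStronglyMeasurable (fun w : (Fin d → ℝ) × (Fin d → ℝ) => f w.1) (pairMeasure d) :=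
    hf.comp_fst
  obtain ⟨h1, h2⟩ := eLpNorm_avgCoord_le k hm hf' hp
  refine ⟨hf'.sub h1, (eLpNorm_sub_le hf' h1 hp).trans ?_⟩
  rw [add_mul, one_mul, ← eLpNorm_comp_fst hf]
  exact add_le_add le_rfl h2

/-- The composition of the averaging operators over the coordinates in a list. -/
noncomputable def avgList (r : Fin d → ℕ) (l : List (Fin d)) (f : (Fin d → ℝ) → ℝ) :
    (Fin d → ℝ) × (Fin d → ℝ) → ℝ :=
  l.foldr (fun k H => avgCoord k (r k) H) fun w => f w.1

/-- Telescoping: writing `A_k` for the average in direction `k` and `A_l` for the composition over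
`l`, `f - A_k A_l f = (f - A_k f) + A_k (f - A_l f)`, and `A_k` is bounded on functions of pairs. -/
theorem exists_eLpNorm_sub_avgList_le {r : Fin d → ℕ} (hr : ∀ i, 1 ≤ r i) (l : List (Fin d)) :
    ∃ C : ℝ≥0∞, C ≠ ∞ ∧ ∀ p : ℝ≥0∞, 1 ≤ p → ∀ f : (Fin d → ℝ) → ℝ,
      AEStronglyMeasurable f (cubeMeasure d) →
      AEStronglyMeasurable (avgList r l f) (pairMeasure d) ∧
      eLpNorm (fun w => f w.1 - avgList r l f w) p (pairMeasure d) ≤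
        C * ∑ k, eLpNorm (devCoord k (r k) f) p (pairMeasure d) := by
  induction l with
  | nil =>
    refine ⟨0, by simp, fun p _ f hf => ⟨hf.comp_fst, ?_⟩⟩
    simp [avgList]
  | cons k l ih =>
    obtain ⟨C, hC, ih⟩ := ih
    refine ⟨1 + (2 ^ r k * r k) * C, ?_, fun p hp f hf => ?_⟩
    · exact ENNReal.add_ne_top.2 ⟨by simp, ENNReal.mul_ne_top
        (ENNReal.mul_ne_top (by simp) (by simp)) hC⟩
    obtain ⟨h1, h2⟩ := ih p hp f hf
    have hf' : AEStronglyMeasurable (fun w : (Fin d → ℝ) × (Fin d → ℝ) => f w.1)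
      (pairMeasure d) := hf.comp_fst
    have h3 := eLpNorm_avgCoord_le k (hr k) (hf'.sub h1) hp
    have h4 := eLpNorm_devCoord_le k (hr k) hf hp
    refine ⟨(eLpNorm_avgCoord_le k (hr k) h1 hp).1, ?_⟩
    have hsplit : (fun w : (Fin d → ℝ) × (Fin d → ℝ) => f w.1 - avgList r (k :: l) f w) =
        devCoord k (r k) f + avgCoord k (r k) fun w => f w.1 - avgList r l f w := by
      rw [avgCoord_sub]
      funext w
      simp [devCoord, avgList]
    rw [hsplit]
    refine (eLpNorm_add_le h4.1 h3.1 hp).trans ?_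
    rw [add_mul, one_mul, mul_assoc]
    refine add_le_add ?_ (h3.2.trans (mul_le_mul' le_rfl h2))
    exact Finset.single_le_sum (f := fun k => eLpNorm (devCoord k (r k) f) p (pairMeasure d))
      (fun _ _ => zero_le) (Finset.mem_univ k)

/-- For finite `p`, on each fibre the integral is bounded by the `L_1` norm, hence by the `L_p` norm
since `ν` is a probability measure; Tonelli concludes. -/
theorem eLpNorm_integral_prod_le {α β : Type*} [MeasurableSpace α] [MeasurableSpace β]
    {μ : Measure α} {ν : Measure β} [SFinite μ] [IsProbabilityMeasure ν] {H : α × β → ℝ}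
    (hH : AEStronglyMeasurable H (μ.prod ν)) {p : ℝ≥0∞} (hp : 1 ≤ p) :
    eLpNorm (fun x => ∫ z, H (x, z) ∂ν) p μ ≤ eLpNorm H p (μ.prod ν) := by
  rcases eq_or_ne p ∞ with rfl | hp'
  · rw [eLpNorm_exponent_top, eLpNorm_exponent_top]
    refine eLpNormEssSup_le_of_ae_enorm_bound ?_
    filter_upwards [Measure.ae_ae_of_ae_prod (ae_le_eLpNormEssSup (f := H) (μ := μ.prod ν))]
      with x hx
    refine (enorm_integral_le_lintegral_enorm _).trans ((lintegral_mono_ae hx).trans ?_)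
    simp
  · have hp0 : p ≠ 0 := (zero_lt_one.trans_le hp).ne'
    have hpos : 0 < p.toReal := ENNReal.toReal_pos hp0 hp'
    rw [eLpNorm_eq_lintegral_rpow_enorm_toReal hp0 hp',
      eLpNorm_eq_lintegral_rpow_enorm_toReal hp0 hp', lintegral_prod _ (hH.enorm.pow_const _)]
    refine ENNReal.rpow_le_rpow (lintegral_mono_ae ?_) (by positivity)
    filter_upwards [hH.prodMk_left] with x hx
    have h1 : ‖∫ z, H (x, z) ∂ν‖ₑ ≤ eLpNorm (fun z => H (x, z)) p ν := by
      refine (enorm_integral_le_lintegral_enorm _).trans ?_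
      rw [← eLpNorm_one_eq_lintegral_enorm]
      exact eLpNorm_le_eLpNorm_of_exponent_le hp hx
    refine (ENNReal.rpow_le_rpow h1 hpos.le).trans_eq ?_
    rw [eLpNorm_eq_lintegral_rpow_enorm_toReal hp0 hp', ← ENNReal.rpow_mul,
      one_div_mul_cancel hpos.ne', ENNReal.rpow_one]

/-- Before direction `k` is treated, its parameter is 0 and the expression does not depend on `z k`;
the value `x k` stored there by `mixCoord` is therefore harmless. For the full list every parameter
is positive, so each term is an invertible affine substitution in `z`. -/
theorem avgList_eq_sum {r : Fin d → ℕ} (hr : ∀ i, 1 ≤ r i) (l : List (Fin d)) (hl : l.Nodup) :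
    ∃ (ι : Type) (_ : Fintype ι) (c : ι → ℝ) (s : ι → Fin d → ℝ),
      (∀ m, ∀ i ∈ l, 0 < s m i ∧ s m i ≤ 1) ∧ (∀ m, ∀ i, i ∉ l → s m i = 0) ∧
      ∀ f w, avgList r l f w = ∑ m, c m * f fun i => (1 - s m i) * w.1 i + s m i * w.2 i := by
  induction l with
  | nil =>
    refine ⟨Unit, inferInstance, fun _ => 1, fun _ _ => 0, by simp, by simp, fun f w => ?_⟩
    simp [avgList]
  | cons k l ih =>
    obtain ⟨ι, hι, c, s, h1, h2, h3⟩ := ih hl.of_cons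
    have hk : k ∉ l := (List.nodup_cons.1 hl).1
    have hr0 : (0 : ℝ) < r k := by exact_mod_cast hr k
    refine ⟨Fin (r k) × ι, inferInstance,
      fun m => (-1 : ℝ) ^ (m.1 : ℕ) * ((r k).choose (m.1 + 1) : ℝ) * c m.2,
      fun m => Function.update (s m.2) k (((m.1 + 1 : ℕ) : ℝ) / r k), ?_, ?_, ?_⟩
    · rintro ⟨j, m⟩ i hi
      rcases eq_or_ne i k with rfl | hik
      · have : ((j + 1 : ℕ) : ℝ) ≤ r i := by exact_mod_cast j.2
        simp only [Function.update_self]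
        exact ⟨by positivity, (div_le_one hr0).2 this⟩
      · simpa [hik] using h1 m i ((List.mem_cons.1 hi).resolve_left hik)
    · rintro ⟨j, m⟩ i hi
      rw [List.mem_cons, not_or] at hi
      simpa [hi.1] using h2 m i hi.2
    · intro f w
      have hcons : avgList r (k :: l) f w = avgCoord k (r k) (avgList r l f) w := rfl
      rw [hcons, avgCoord, Fintype.sum_prod_type, ← Fin.sum_univ_eq_sum_range (fun j =>
        (-1 : ℝ) ^ j * ((r k).choose (j + 1) : ℝ) *
          avgList r l f (mixCoord k (((j + 1 : ℕ) : ℝ) / r k) w))]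
      refine Finset.sum_congr rfl fun j _ => ?_
      rw [h3, Finset.mul_sum]
      refine Finset.sum_congr rfl fun m _ => ?_
      rw [← mul_assoc]
      congr 2
      funext i
      rcases eq_or_ne i k with rfl | hik
      · simp [mixCoord, h2 m i hk]
      · simp [mixCoord, hik]

/-! ### The smoothing operator and its continuous kernel -/

/-- A continuous probability density on `ℝ^d` that vanishes outside the unit cube. -/
noncomputable def bump (z : Fin d → ℝ) : ℝ := ∏ i, max 0 (6 * (z i * (1 - z i)))

theorem continuous_bump : Continuous (bump : (Fin d → ℝ) → ℝ) := by
  unfold bump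
  fun_prop

theorem bump_nonneg (z : Fin d → ℝ) : 0 ≤ bump z :=
  Finset.prod_nonneg fun _ _ => le_max_left _ _

theorem bump_le (z : Fin d → ℝ) : bump z ≤ (3 / 2) ^ d := by
  calc bump z ≤ ∏ _i : Fin d, (3 / 2 : ℝ) :=
        Finset.prod_le_prod (fun _ _ => le_max_left _ _) fun i _ =>
          max_le (by norm_num) (by nlinarith [sq_nonneg (2 * z i - 1)])
    _ = _ := by simp [div_pow]

theorem bump_eq_zero {z : Fin d → ℝ} (hz : z ∉ cube d) : bump z = 0 := by
  simp only [cube, box, Set.mem_ofPred_eq, not_forall] at hz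
  obtain ⟨i, hi⟩ := hz
  refine Finset.prod_eq_zero (Finset.mem_univ i) (max_eq_left ?_)
  simp only [Pi.zero_apply, Pi.one_apply, Set.mem_Icc, not_and_or, not_le] at hi
  rcases hi with hi | hi <;> nlinarith

theorem integral_bump : ∫ z, bump z ∂cubeMeasure d = 1 := by
  have h1 : ∫ z, bump z ∂cubeMeasure d = ∫ z : Fin d → ℝ, bump z :=
    setIntegral_eq_integral_of_forall_compl_eq_zero fun z hz => bump_eq_zero hz
  have h2 : ∫ x : ℝ, max 0 (6 * (x * (1 - x))) = 1 := by
    rw [← setIntegral_eq_integral_of_forall_compl_eq_zero (s := Set.Ioc (0 : ℝ) 1),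
      ← intervalIntegral.integral_of_le zero_le_one]
    · have : ∫ x in (0 : ℝ)..1, max 0 (6 * (x * (1 - x))) =
          ∫ x in (0 : ℝ)..1, (6 * x - 6 * x ^ 2) := by
        refine intervalIntegral.integral_congr fun x hx => ?_
        rw [Set.uIcc_of_le zero_le_one] at hx
        rw [max_eq_right (mul_nonneg (by norm_num) (mul_nonneg hx.1 (sub_nonneg.2 hx.2)))]
        ring
      rw [this, intervalIntegral.integral_sub (Continuous.intervalIntegrable (by fun_prop) _ _)
        (Continuous.intervalIntegrable (by fun_prop) _ _), intervalIntegral.integral_const_mul,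
        intervalIntegral.integral_const_mul, integral_id, integral_pow]
      norm_num
    · intro x hx
      simp only [Set.mem_Ioc, not_and_or, not_lt, not_le] at hx
      refine max_eq_left ?_
      rcases hx with hx | hx <;> nlinarith
  rw [h1]
  unfold bump
  rw [integral_fintype_prod_volume_eq_prod (fun (_ : Fin d) x => max 0 (6 * (x * (1 - x)))), h2]
  simp

theorem isCompact_cube : IsCompact (cube d) := by
  rw [cube, box_eq_Icc]
  exact isCompact_Icc

section AffineStep

variable {s x : Fin d → ℝ}

theorem map_convexComb (hs : ∀ i, 0 < s i) :
    Measure.map (fun z i => (1 - s i) * x i + s i * z i) (volume : Measure (Fin d → ℝ)) =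
      ENNReal.ofReal (∏ i, s i)⁻¹ • volume := by
  have h := map_diagonal_affine (fun i => (hs i).ne') fun i => (1 - s i) * x i
  rw [abs_of_pos (inv_pos.2 (Finset.prod_pos fun i _ => hs i))] at h
  rw [← h]
  congr 1
  funext z i
  ring

theorem convexComb_mem (hs : ∀ i, 0 < s i ∧ s i ≤ 1) (hx : x ∈ cube d) {z : Fin d → ℝ}
    (hz : z ∈ cube d) : (fun i => (1 - s i) * x i + s i * z i) ∈ cube d := by
  intro i
  have hx' := hx i
  have hz' := hz i
  obtain ⟨h1, h2⟩ := hs i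
  simp only [Pi.zero_apply, Pi.one_apply, Set.mem_Icc] at hx' hz' ⊢
  constructor <;> nlinarith

theorem integrable_comp_convexComb (hs : ∀ i, 0 < s i ∧ s i ≤ 1) (hx : x ∈ cube d)
    {f : (Fin d → ℝ) → ℝ} (hf : Integrable f (cubeMeasure d)) :
    Integrable (fun z => f fun i => (1 - s i) * x i + s i * z i) (cubeMeasure d) := by
  have hm : Measurable fun (z : Fin d → ℝ) i => (1 - s i) * x i + s i * z i := by fun_prop
  have hle := map_restrict_le hm (map_convexComb (x := x) fun i => (hs i).1).le
    (measurableSet_box 0 1) (s := cube d) fun z hz => convexComb_mem hs hx hz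
  have h1 : Integrable f (Measure.map (fun z i => (1 - s i) * x i + s i * z i)
      (cubeMeasure d)) := (hf.smul_measure ENNReal.ofReal_ne_top).mono_measure hle
  exact h1.comp_measurable hm

theorem integral_bump_mul_convexComb (hs : ∀ i, 0 < s i ∧ s i ≤ 1) (hx : x ∈ cube d)
    (f : (Fin d → ℝ) → ℝ) :
    ∫ z, bump z * f (fun i => (1 - s i) * x i + s i * z i) ∂cubeMeasure d =
      ∫ y, (∏ i, s i)⁻¹ * bump (fun i => (y i - (1 - s i) * x i) / s i) * f y
        ∂cubeMeasure d := by
  let A : (Fin d → ℝ) → (Fin d → ℝ) := fun z i => (1 - s i) * x i + s i * z i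
  have hA : Continuous A := by fun_prop
  have hinv : ∀ z, (fun i => (A z i - (1 - s i) * x i) / s i) = z := fun z => by
    funext i
    have := (hs i).1.ne'
    simp only [A]
    field_simp
    ring
  have hinj : Function.Injective A := fun z z' h => by rw [← hinv z, h, hinv z']
  have hemb : MeasurableEmbedding A := hA.measurableEmbedding hinj
  let φ : (Fin d → ℝ) → ℝ := fun y => bump (fun i => (y i - (1 - s i) * x i) / s i) * f y
  -- `A` maps the cube into itself, so the domain may be enlarged to the preimage of the cube:
  -- `bump` vanishes on the added part.
  calc ∫ z, bump z * f (A z) ∂cubeMeasure d = ∫ z in A ⁻¹' cube d, φ (A z) := by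
        simp only [φ, hinv]
        refine (setIntegral_eq_of_subset_of_forall_sdiff_eq_zero
          (hA.measurable (measurableSet_box _ _)) (fun z hz => convexComb_mem hs hx hz)
          fun z hz => ?_).symm
        rw [bump_eq_zero hz.2, zero_mul]
    _ = ∫ y in cube d, φ y ∂Measure.map A volume := (hemb.setIntegral_map φ _).symm
    _ = (∏ i, s i)⁻¹ * ∫ y, φ y ∂cubeMeasure d := by
        rw [map_convexComb fun i => (hs i).1, Measure.restrict_smul, integral_smul_measure,
          ENNReal.toReal_ofReal (inv_nonneg.2 (Finset.prod_nonneg fun i _ => (hs i).1.le)),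
          smul_eq_mul]
    _ = _ := by
        rw [← integral_const_mul]
        simp only [φ, mul_assoc]

end AffineStep

theorem integrable_continuous_mul {g f : (Fin d → ℝ) → ℝ} (hg : Continuous g)
    (hf : Integrable f (cubeMeasure d)) : Integrable (fun y => g y * f y) (cubeMeasure d) :=
  IntegrableOn.continuousOn_mul hg.continuousOn hf isCompact_cube

/-- Substituting `y = (1 - s) x + s z` in each term turns `bump z` into a kernel in `x` and `y`. It
is continuous because `bump` is continuous on the whole space; a cut-off density would leave jumps.
-/
theorem exists_continuous_kernel {r : Fin d → ℕ} (hr : ∀ i, 1 ≤ r i) :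
    ∃ κ : (Fin d → ℝ) → (Fin d → ℝ) → ℝ, Continuous (Function.uncurry κ) ∧
      ∀ f : (Fin d → ℝ) → ℝ, Integrable f (cubeMeasure d) → ∀ x ∈ cube d,
        Integrable (fun z => bump z * avgList r (List.finRange d) f (x, z)) (cubeMeasure d) ∧
        ∫ z, bump z * avgList r (List.finRange d) f (x, z) ∂cubeMeasure d =
          ∫ y, κ x y * f y ∂cubeMeasure d := by
  obtain ⟨ι, _, c, s, hs, -, hsum⟩ := avgList_eq_sum hr _ (List.nodup_finRange d)
  replace hs : ∀ m i, 0 < s m i ∧ s m i ≤ 1 := fun m i => hs m i (List.mem_finRange i)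
  refine ⟨fun x y => ∑ m, c m * ((∏ i, s m i)⁻¹ *
    bump fun i => (y i - (1 - s m i) * x i) / s m i), ?_, fun f hf x hx => ?_⟩
  · refine continuous_finsetSum _ fun m _ => ?_
    refine continuous_const.mul (continuous_const.mul (continuous_bump.comp ?_))
    fun_prop
  · have hint1 : ∀ m ∈ Finset.univ, Integrable (fun z => c m * (bump z *
        f fun i => (1 - s m i) * x i + s m i * z i)) (cubeMeasure d) := fun m _ =>
      (integrable_continuous_mul continuous_bump
        (integrable_comp_convexComb (hs m) hx hf)).const_mul _
    have hint2 : ∀ m ∈ Finset.univ, Integrable (fun y => c m * ((∏ i, s m i)⁻¹ *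
        bump (fun i => (y i - (1 - s m i) * x i) / s m i) * f y)) (cubeMeasure d) := by
      intro m _
      have hg : Continuous fun y : Fin d → ℝ => (∏ i, s m i)⁻¹ *
          bump fun i => (y i - (1 - s m i) * x i) / s m i :=
        continuous_const.mul (continuous_bump.comp (by fun_prop))
      exact (integrable_continuous_mul hg hf).const_mul _
    have heq : (fun z => bump z * avgList r (List.finRange d) f (x, z)) = fun z =>
        ∑ m, c m * (bump z * f fun i => (1 - s m i) * x i + s m i * z i) := by
      funext z
      rw [hsum, Finset.mul_sum]
      exact Finset.sum_congr rfl fun m _ => by ring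
    rw [heq]
    refine ⟨integrable_finsetSum _ hint1, ?_⟩
    have heq2 : (fun y => (∑ m, c m * ((∏ i, s m i)⁻¹ *
        bump fun i => (y i - (1 - s m i) * x i) / s m i)) * f y) = fun y => ∑ m, c m *
        ((∏ i, s m i)⁻¹ * bump (fun i => (y i - (1 - s m i) * x i) / s m i) * f y) := by
      funext y
      rw [Finset.sum_mul]
      exact Finset.sum_congr rfl fun m _ => by ring
    rw [heq2, integral_finsetSum _ hint1, integral_finsetSum _ hint2]
    refine Finset.sum_congr rfl fun m _ => ?_
    rw [integral_const_mul, integral_const_mul, integral_bump_mul_convexComb (hs m) hx]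

/-- Since `bump` has integral 1, `f x` minus its image is the integral of `bump z` times `f x` minus
the average at `(x, z)`. -/
theorem eLpNorm_sub_kernel_le {r : Fin d → ℕ} {κ : (Fin d → ℝ) → (Fin d → ℝ) → ℝ}
    {f : (Fin d → ℝ) → ℝ}
    (hκ : ∀ x ∈ cube d,
        Integrable (fun z => bump z * avgList r (List.finRange d) f (x, z)) (cubeMeasure d) ∧
        ∫ z, bump z * avgList r (List.finRange d) f (x, z) ∂cubeMeasure d =
          ∫ y, κ x y * f y ∂cubeMeasure d)
    (hm : AEStronglyMeasurable
      (fun w => f w.1 - avgList r (List.finRange d) f w) (pairMeasure d))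
    {p : ℝ≥0∞} (hp : 1 ≤ p) :
    eLpNorm (fun x => f x - ∫ y, κ x y * f y ∂cubeMeasure d) p (cubeMeasure d) ≤
      ENNReal.ofReal ((3 / 2) ^ d) *
        eLpNorm (fun w => f w.1 - avgList r (List.finRange d) f w) p (pairMeasure d) := by
  have hbm : Measurable fun w : (Fin d → ℝ) × (Fin d → ℝ) => bump w.2 :=
    continuous_bump.measurable.comp measurable_snd
  calc _ = eLpNorm (fun x => ∫ z, (fun w : (Fin d → ℝ) × (Fin d → ℝ) => bump w.2 *
        (f w.1 - avgList r (List.finRange d) f w)) (x, z) ∂cubeMeasure d) p (cubeMeasure d) := by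
        refine eLpNorm_congr_ae ?_
        filter_upwards [ae_restrict_mem (measurableSet_box _ _)] with x hx
        obtain ⟨h1, h2⟩ := hκ x hx
        have h3 : Integrable (bump : (Fin d → ℝ) → ℝ) (cubeMeasure d) :=
          continuous_bump.continuousOn.integrableOn_compact isCompact_cube
        simp only [mul_sub]
        rw [integral_sub (h3.mul_const _) h1, h2, integral_mul_const, integral_bump, one_mul]
    _ ≤ eLpNorm (fun w : (Fin d → ℝ) × (Fin d → ℝ) => bump w.2 *
        (f w.1 - avgList r (List.finRange d) f w)) p (pairMeasure d) :=
        eLpNorm_integral_prod_le (hbm.aestronglyMeasurable.mul hm) hp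
    _ ≤ _ := by
        refine eLpNorm_le_mul_eLpNorm_of_ae_le_mul (Filter.Eventually.of_forall fun w => ?_) p
        rw [norm_mul, Real.norm_of_nonneg (bump_nonneg _)]
        exact mul_le_mul_of_nonneg_right (bump_le _) (norm_nonneg _)

/-! ### Polynomials with bounded partial degrees -/

section PolynomialSpaces

theorem C_mem_polys {r : Fin d → ℕ} (hr : ∀ i, 1 ≤ r i) (c : ℝ) :
    MvPolynomial.C c ∈ polys r := by
  intro m hm i
  rw [MvPolynomial.C_apply] at hm
  rw [Finset.mem_singleton.1 (MvPolynomial.support_monomial_subset hm)]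
  exact hr i

theorem sum_mem_polys {r : Fin d → ℕ} {ι : Type*} {s : Finset ι}
    {φ : ι → MvPolynomial (Fin d) ℝ} (h : ∀ j ∈ s, φ j ∈ polys r) : ∑ j ∈ s, φ j ∈ polys r := by
  classical
  intro m hm i
  obtain ⟨j, hj, hjm⟩ := Finset.mem_biUnion.1 (MvPolynomial.support_sum hm)
  exact h j hj m hjm i

theorem add_mem_polys {r : Fin d → ℕ} {φ ψ : MvPolynomial (Fin d) ℝ} (hφ : φ ∈ polys r)
    (hψ : ψ ∈ polys r) : φ + ψ ∈ polys r := by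
  classical
  intro m hm i
  rcases Finset.mem_union.1 (MvPolynomial.support_add hm) with h | h
  exacts [hφ m h i, hψ m h i]

/-- The bounds are strict: degrees at most `r i - 1` and `s i - 1` add up to at most `r i + s i -
2`. -/
theorem mul_mem_polys {r s t : Fin d → ℕ} {φ ψ : MvPolynomial (Fin d) ℝ} (hφ : φ ∈ polys r)
    (hψ : ψ ∈ polys s) (h : ∀ i, r i + s i ≤ t i + 1) : φ * ψ ∈ polys t := by
  classical
  intro m hm i
  obtain ⟨m₁, h₁, m₂, h₂, rfl⟩ := Finset.mem_add.1 (MvPolynomial.support_mul _ _ hm)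
  have h1 := hφ m₁ h₁ i
  have h2 := hψ m₂ h₂ i
  have h3 := h i
  rw [Finsupp.add_apply]
  omega

theorem C_mul_mem_polys {r : Fin d → ℕ} {φ : MvPolynomial (Fin d) ℝ} (hφ : φ ∈ polys r) (c : ℝ) :
    MvPolynomial.C c * φ ∈ polys r :=
  mul_mem_polys (C_mem_polys (fun _ => le_rfl) c) hφ fun i => by omega

theorem aeval_X_mem_polys {P : Polynomial ℝ} {m : ℕ} (hP : P.natDegree < m) (i : Fin d) :
    Polynomial.aeval (MvPolynomial.X i) P ∈ polys fun j : Fin d => if j = i then m else 1 := by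
  rw [Polynomial.aeval_eq_sum_range]
  refine sum_mem_polys fun n hn => ?_
  rw [MvPolynomial.X_pow_eq_monomial, MvPolynomial.smul_monomial]
  intro v hv j
  rw [Finset.mem_singleton.1 (MvPolynomial.support_monomial_subset hv)]
  rcases eq_or_ne j i with rfl | h
  · simpa using lt_of_le_of_lt (Finset.mem_range_succ_iff.1 hn) hP
  · simp [h, Finsupp.single_eq_of_ne h]

theorem eval_aeval_X (P : Polynomial ℝ) (i : Fin d) (x : Fin d → ℝ) :
    MvPolynomial.eval x (Polynomial.aeval (MvPolynomial.X i) P) = P.eval (x i) := by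
  rw [Polynomial.aeval_def, Polynomial.hom_eval₂, MvPolynomial.eval_X]
  have : (MvPolynomial.eval x).comp (algebraMap ℝ (MvPolynomial (Fin d) ℝ)) = RingHom.id ℝ := by
    ext c
    simp
  rw [this, Polynomial.eval₂_id]

theorem prod_aeval_X_mem_polys {r : Fin d → ℕ} {P : Fin d → Polynomial ℝ}
    (hP : ∀ i, (P i).natDegree < r i) (s : Finset (Fin d)) :
    ∏ i ∈ s, Polynomial.aeval (MvPolynomial.X i) (P i) ∈
      polys fun j : Fin d => if j ∈ s then r j else 1 := by
  induction s using Finset.induction_on with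
  | empty => simpa using C_mem_polys (d := d) (r := fun _ => 1) (fun _ => le_rfl) 1
  | insert i s hi ih =>
    rw [Finset.prod_insert hi]
    refine mul_mem_polys (aeval_X_mem_polys (hP i) i) ih fun j => ?_
    rcases eq_or_ne j i with rfl | h
    · simp [hi]
    · simp [h, add_comm]

theorem exists_eval_comp_affine {r : Fin d → ℕ} {φ : MvPolynomial (Fin d) ℝ} (hφ : φ ∈ polys r)
    (α β : Fin d → ℝ) :
    ∃ ψ ∈ polys r, ∀ x, MvPolynomial.eval x ψ = MvPolynomial.eval (fun i => α i * x i + β i) φ := by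
  refine ⟨∑ m ∈ φ.support, MvPolynomial.C (φ.coeff m) * ∏ i, Polynomial.aeval (MvPolynomial.X i)
    ((Polynomial.C (α i) * Polynomial.X + Polynomial.C (β i)) ^ m i), ?_, fun x => ?_⟩
  · refine sum_mem_polys fun m hm => C_mul_mem_polys ?_ _
    have h := prod_aeval_X_mem_polys (r := r)
      (P := fun i => (Polynomial.C (α i) * Polynomial.X + Polynomial.C (β i)) ^ m i) (fun i => ?_)
      Finset.univ
    · simpa only [Finset.mem_univ, if_true] using h
    · refine lt_of_le_of_lt (Polynomial.natDegree_pow_le_of_le (m i) (m := 1) ?_)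
        (by simpa using hφ m hm i)
      compute_degree
  · rw [MvPolynomial.eval_eq' _ φ, map_sum]
    refine Finset.sum_congr rfl fun m _ => ?_
    rw [map_mul, MvPolynomial.eval_C, map_prod]
    congr 1
    refine Finset.prod_congr rfl fun i _ => ?_
    rw [eval_aeval_X]
    simp

end PolynomialSpaces

/-! ### Continuous functions of one variable with vanishing differences -/

section OneVariable

theorem sum_alternating_choose_eval_eq_zero {m : ℕ} {P : Polynomial ℝ} (hP : P.natDegree < m)
    (x η : ℝ) :
    ∑ j ∈ Finset.range (m + 1),
      (-1 : ℝ) ^ (m - j) * (m.choose j : ℝ) * P.eval (x + (j : ℝ) * η) = 0 := by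
  simp only [Polynomial.eval_eq_sum_range' hP, Finset.mul_sum]
  rw [Finset.sum_comm]
  refine Finset.sum_eq_zero fun n hn => ?_
  have h := sum_alternating_choose_pow_eq_zero (Finset.mem_range.1 hn) x η
  calc _ = P.coeff n * ∑ j ∈ Finset.range (m + 1),
        (-1 : ℝ) ^ (m - j) * (m.choose j : ℝ) * (x + (j : ℝ) * η) ^ n := by
        rw [Finset.mul_sum]
        exact Finset.sum_congr rfl fun j _ => by ring
    _ = 0 := by rw [h, mul_zero]

/-- The last coefficient of the difference is 1, so each value is determined by the `m` preceding
ones. -/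
theorem eq_zero_of_differences_eq_zero {m N : ℕ} {v : ℕ → ℝ}
    (hv : ∀ k, k + m ≤ N → ∑ j ∈ Finset.range (m + 1),
      (-1 : ℝ) ^ (m - j) * (m.choose j : ℝ) * v (k + j) = 0)
    (h0 : ∀ k < m, v k = 0) : ∀ k ≤ N, v k = 0 := by
  intro k
  induction k using Nat.strong_induction_on with
  | _ k ih =>
    intro hk
    rcases lt_or_ge k m with h | h
    · exact h0 k h
    · have h1 := hv (k - m) (by omega)
      rw [Finset.sum_range_succ, Finset.sum_eq_zero, zero_add] at h1
      · simpa [Nat.sub_add_cancel h] using h1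
      · intro j hj
        have hj' := Finset.mem_range.1 hj
        rw [ih (k - m + j) (by omega) (by omega), mul_zero]

/-- The polynomial of degree less than `m` that interpolates `u` at the first `m` points of the
grid of step `1 / N`. -/
noncomputable def gridInterpolant (u : ℝ → ℝ) (m N : ℕ) : Polynomial ℝ :=
  Lagrange.interpolate (Finset.range m) (fun k : ℕ => (k : ℝ) / N) fun k => u ((k : ℝ) / N)

theorem injOn_grid {N : ℕ} (hN : 1 ≤ N) (s : Set ℕ) :
    Set.InjOn (fun k : ℕ => (k : ℝ) / N) s := by
  intro k _ l _ h
  have : (N : ℝ) ≠ 0 := by positivity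
  simpa [div_left_inj' this] using h

variable {u : ℝ → ℝ} {m : ℕ}

/-- The endpoints `k / N` and `(k + m) / N` give step `1 / N`. Hence `u` minus its interpolant has
vanishing differences along the grid and `m` initial zeros. -/
theorem eq_gridInterpolant_on_grid (hm : 1 ≤ m)
    (hu : ∀ x ∈ Set.Icc (0 : ℝ) 1, ∀ z ∈ Set.Icc (0 : ℝ) 1, ∑ j ∈ Finset.range (m + 1),
      (-1 : ℝ) ^ (m - j) * (m.choose j : ℝ) * u (x + (j : ℝ) * ((z - x) / m)) = 0)
    {N : ℕ} (hN : 1 ≤ N) {k : ℕ} (hk : k ≤ N) :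
    u ((k : ℝ) / N) = (gridInterpolant u m N).eval ((k : ℝ) / N) := by
  have hN0 : (0 : ℝ) < N := by exact_mod_cast hN
  have hm0 : (0 : ℝ) < m := by exact_mod_cast hm
  have hdeg : (gridInterpolant u m N).natDegree < m := by
    have h := Lagrange.degree_interpolate_lt (s := Finset.range m) (fun k => u ((k : ℝ) / N))
      (injOn_grid hN _)
    rw [Finset.card_range] at h
    rcases eq_or_ne (gridInterpolant u m N) 0 with h0 | h0
    · rw [h0, Polynomial.natDegree_zero]
      exact hm
    · exact (Polynomial.natDegree_lt_iff_degree_lt h0).2 h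
  refine sub_eq_zero.1 (eq_zero_of_differences_eq_zero (m := m) (N := N)
    (v := fun k => u ((k : ℝ) / N) - (gridInterpolant u m N).eval ((k : ℝ) / N))
    (fun k hk => ?_) (fun k hk => ?_) k hk)
  · have hpt : ∀ j : ℕ, ((k + j : ℕ) : ℝ) / N = (k : ℝ) / N + (j : ℝ) * (1 / N) := fun j => by
      push_cast
      ring
    have hstep : (((k + m : ℕ) : ℝ) / N - (k : ℝ) / N) / m = 1 / N := by
      push_cast
      field_simp
      ring
    have h1 := hu ((k : ℝ) / N) ⟨by positivity, (div_le_one hN0).2 (by exact_mod_cast (by omega))⟩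
      (((k + m : ℕ) : ℝ) / N) ⟨by positivity, (div_le_one hN0).2 (by exact_mod_cast hk)⟩
    rw [hstep] at h1
    have h2 := sum_alternating_choose_eval_eq_zero hdeg ((k : ℝ) / N) (1 / N)
    simp only [hpt, mul_sub, Finset.sum_sub_distrib]
    rw [h1, h2, sub_zero]
  · rw [sub_eq_zero]
    exact (Lagrange.eval_interpolate_at_node (fun k : ℕ => u ((k : ℝ) / N)) (injOn_grid hN _)
      (Finset.mem_range.2 hk)).symm

/-- The grid of step `1 / (M m)` contains that of step `1 / m`. Both interpolants thus equal `u` at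
the same `m` nodes, and their degrees are below `m`. -/
theorem gridInterpolant_refine (hm : 1 ≤ m)
    (hu : ∀ x ∈ Set.Icc (0 : ℝ) 1, ∀ z ∈ Set.Icc (0 : ℝ) 1, ∑ j ∈ Finset.range (m + 1),
      (-1 : ℝ) ^ (m - j) * (m.choose j : ℝ) * u (x + (j : ℝ) * ((z - x) / m)) = 0)
    {M : ℕ} (hM : 1 ≤ M) : gridInterpolant u m (M * m) = gridInterpolant u m m := by
  have hMm : 1 ≤ M * m := Nat.mul_pos hM hm
  have hdeg : ∀ N, 1 ≤ N → (gridInterpolant u m N).degree < ((Finset.range m).card : ℕ) :=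
    fun N hN => Lagrange.degree_interpolate_lt _ (injOn_grid hN _)
  refine Polynomial.eq_of_degrees_lt_of_eval_index_eq (v := fun k : ℕ => (k : ℝ) / m)
    (Finset.range m) (injOn_grid hm _) (hdeg _ hMm) (hdeg _ hm) fun k hk => ?_
  have hk' : k ≤ m := (Finset.mem_range.1 hk).le
  have h1 := eq_gridInterpolant_on_grid hm hu hMm (Nat.mul_le_mul_left M hk')
  have hpt : ((M * k : ℕ) : ℝ) / ((M * m : ℕ) : ℝ) = (k : ℝ) / m := by
    push_cast
    have : (M : ℝ) ≠ 0 := by positivity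
    rw [mul_div_mul_left _ _ this]
  rw [hpt] at h1
  rw [← h1, eq_gridInterpolant_on_grid hm hu hm hk']

theorem eq_gridInterpolant (hm : 1 ≤ m) (hcont : ContinuousOn u (Set.Icc 0 1))
    (hu : ∀ x ∈ Set.Icc (0 : ℝ) 1, ∀ z ∈ Set.Icc (0 : ℝ) 1, ∑ j ∈ Finset.range (m + 1),
      (-1 : ℝ) ^ (m - j) * (m.choose j : ℝ) * u (x + (j : ℝ) * ((z - x) / m)) = 0)
    {x : ℝ} (hx : x ∈ Set.Icc (0 : ℝ) 1) : u x = (gridInterpolant u m m).eval x := by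
  -- Points of ever finer grids that converge to `x`; at all of them `u` equals one fixed
  -- polynomial.
  let y : ℕ → ℝ := fun M => (⌊x * ((M * m : ℕ) : ℝ)⌋₊ : ℝ) / ((M * m : ℕ) : ℝ)
  have hMm : Filter.Tendsto (fun M : ℕ => ((M * m : ℕ) : ℝ)) Filter.atTop Filter.atTop :=
    tendsto_natCast_atTop_atTop.comp (Filter.tendsto_atTop_mono
      (fun M => Nat.le_mul_of_pos_right M hm) Filter.tendsto_id)
  have hy : Filter.Tendsto y Filter.atTop (nhds x) :=
    (tendsto_nat_floor_mul_div_atTop hx.1).comp hMm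
  have hfloor : ∀ M : ℕ, ⌊x * ((M * m : ℕ) : ℝ)⌋₊ ≤ M * m := fun M =>
    Nat.floor_le_of_le (mul_le_of_le_one_left (Nat.cast_nonneg _) hx.2)
  have hmem : ∀ M, y M ∈ Set.Icc (0 : ℝ) 1 := fun M =>
    ⟨by positivity, div_le_one_of_le₀ (by exact_mod_cast hfloor M) (by positivity)⟩
  have h1 : Filter.Tendsto (fun M => u (y M)) Filter.atTop (nhds (u x)) :=
    (hcont x hx).tendsto.comp (tendsto_nhdsWithin_iff.2 ⟨hy, Filter.Eventually.of_forall hmem⟩)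
  have h2 : Filter.Tendsto (fun M => (gridInterpolant u m m).eval (y M)) Filter.atTop
      (nhds ((gridInterpolant u m m).eval x)) :=
    ((gridInterpolant u m m).continuous.tendsto x).comp hy
  refine tendsto_nhds_unique h1 (h2.congr' ?_)
  filter_upwards [Filter.eventually_ge_atTop 1] with M hM
  rw [← gridInterpolant_refine hm hu hM]
  exact (eq_gridInterpolant_on_grid hm hu (Nat.mul_pos hM hm) (hfloor M)).symm

end OneVariable

/-! ### Continuous functions of several variables with vanishing differences -/

theorem update_mem_cube {x : Fin d → ℝ} (hx : x ∈ cube d) (i : Fin d) {t : ℝ}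
    (ht : t ∈ Set.Icc (0 : ℝ) 1) : Function.update x i t ∈ cube d := by
  intro j
  rcases eq_or_ne j i with rfl | h
  · simpa using ht
  · simpa [h] using hx j

/-- On each segment parallel to an axis the function equals its Lagrange interpolant, with the same
nodes for all parallel segments. Iterating over the coordinates gives tensor-product interpolation.
-/
theorem exists_eval_eq_of_coordDiff_eq_zero {r : Fin d → ℕ} (hr : ∀ i, 1 ≤ r i)
    {g : (Fin d → ℝ) → ℝ} (hcont : ContinuousOn g (cube d))
    (hg : ∀ i, ∀ x ∈ cube d, ∀ z ∈ Set.Icc (0 : ℝ) 1,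
      coordDiff i (r i) ((z - x i) / r i) g x = 0) :
    ∃ φ ∈ polys r, ∀ x ∈ cube d, g x = MvPolynomial.eval x φ := by
  have hinterp : ∀ i, ∀ x ∈ cube d, g x = ∑ k ∈ Finset.range (r i),
      (Lagrange.basis (Finset.range (r i)) (fun k : ℕ => (k : ℝ) / r i) k).eval (x i) *
        g (Function.update x i ((k : ℝ) / r i)) := by
    intro i x hx
    have hc : ContinuousOn (fun t => g (Function.update x i t)) (Set.Icc 0 1) :=
      hcont.comp (by fun_prop) fun t ht => update_mem_cube hx i ht
    have h := eq_gridInterpolant (hr i) hc (fun s hs z hz => ?_) (hx i)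
    · rw [Function.update_eq_self] at h
      rw [h, gridInterpolant, Lagrange.interpolate_apply, Polynomial.eval_finsetSum]
      exact Finset.sum_congr rfl fun k _ => by simp [mul_comm]
    · simpa [coordDiff] using hg i _ (update_mem_cube hx i hs) z hz
  -- Coordinates outside `s` are frozen at `y`. The degree bound 1 there means that the polynomial
  -- does not involve them.
  suffices H : ∀ s : Finset (Fin d), ∀ y ∈ cube d,
      ∃ φ ∈ polys fun j => if j ∈ s then r j else 1,
        ∀ x ∈ cube d, (∀ j ∉ s, x j = y j) → g x = MvPolynomial.eval x φ by
    obtain ⟨φ, hφ, h⟩ := H Finset.univ 0 (fun i => by simp)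
    exact ⟨φ, by simpa only [Finset.mem_univ, if_true] using hφ,
      fun x hx => h x hx fun j hj => absurd (Finset.mem_univ j) hj⟩
  intro s
  induction s using Finset.induction_on with
  | empty =>
    intro y _
    refine ⟨MvPolynomial.C (g y), C_mem_polys (fun _ => by simp) _, fun x _ hxy => ?_⟩
    rw [funext fun j => hxy j (Finset.notMem_empty j), MvPolynomial.eval_C]
  | insert i s hi ih =>
    intro y hy
    have hnode : ∀ k ∈ Finset.range (r i), (k : ℝ) / r i ∈ Set.Icc (0 : ℝ) 1 := fun k hk =>
      ⟨by positivity, div_le_one_of_le₀ (by exact_mod_cast (Finset.mem_range.1 hk).le)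
        (by positivity)⟩
    have hk := fun k : Finset.range (r i) =>
      ih (Function.update y i ((k : ℕ) / r i)) (update_mem_cube hy i (hnode k k.2))
    choose φ hφ hφg using hk
    refine ⟨∑ k : Finset.range (r i), Polynomial.aeval (MvPolynomial.X i)
      (Lagrange.basis (Finset.range (r i)) (fun k : ℕ => (k : ℝ) / r i) k) * φ k,
      sum_mem_polys fun k _ => ?_, fun x hx hxy => ?_⟩
    · refine mul_mem_polys (aeval_X_mem_polys (m := r i) ?_ i) (hφ k) fun j => ?_
      · rw [Lagrange.natDegree_basis (injOn_grid (hr i) _) k.2, Finset.card_range]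
        exact Nat.sub_lt (hr i) one_pos
      · rcases eq_or_ne j i with rfl | h
        · simp [hi]
        · simp [h, add_comm]
    · rw [hinterp i x hx, map_sum, ← Finset.sum_coe_sort]
      refine Finset.sum_congr rfl fun k _ => ?_
      have h1 := hφg k (Function.update x i ((k : ℕ) / r i))
        (update_mem_cube hx i (hnode k k.2)) fun j hj => ?_
      · rw [map_mul, eval_aeval_X, h1]
        congr 1
        -- As `i ∉ s`, `φ k` does not involve the variable `i`, so replacing `x i` by the node
        -- leaves its value unchanged.
        rw [MvPolynomial.eval_eq, MvPolynomial.eval_eq]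
        refine Finset.sum_congr rfl fun c hc => congrArg _ (Finset.prod_congr rfl fun j hjc => ?_)
        rcases eq_or_ne j i with rfl | h
        · have := hφ k c hc j
          simp only [hi, if_false, Nat.lt_one_iff] at this
          exact absurd this (Finsupp.mem_support_iff.1 hjc)
        · simp [h]
      · rcases eq_or_ne j i with rfl | h
        · simp
        · simpa [h] using hxy j (by simp [h, hj])

/-! ### Compactness of integral operators with continuous kernel -/

section Compactness

variable {κ : (Fin d → ℝ) → (Fin d → ℝ) → ℝ}

theorem abs_integral_kernel_sub_le (hκ : Continuous (Function.uncurry κ)) {f : (Fin d → ℝ) → ℝ}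
    (hf : Integrable f (cubeMeasure d)) {x x' : Fin d → ℝ} {δ : ℝ}
    (h : ∀ y ∈ cube d, |κ x y - κ x' y| ≤ δ) :
    |∫ y, κ x y * f y ∂cubeMeasure d - ∫ y, κ x' y * f y ∂cubeMeasure d| ≤
      δ * ∫ y, |f y| ∂cubeMeasure d := by
  have hc : ∀ x, Integrable (fun y => κ x y * f y) (cubeMeasure d) := fun x =>
    integrable_continuous_mul (hκ.comp (by fun_prop : Continuous fun y => (x, y))) hf
  rw [← integral_sub (hc x) (hc x'), ← integral_const_mul]
  refine (norm_integral_le_integral_norm _).trans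
    (integral_mono_ae ((hc x).sub (hc x')).norm (hf.abs.const_mul δ) ?_)
  filter_upwards [ae_restrict_mem (measurableSet_box _ _)] with y hy
  simp only [Pi.sub_apply]
  rw [← sub_mul, norm_mul]
  exact mul_le_mul_of_nonneg_right (h y hy) (abs_nonneg _)

theorem abs_integral_kernel_le (hκ : Continuous (Function.uncurry κ)) {f : (Fin d → ℝ) → ℝ}
    (hf : Integrable f (cubeMeasure d)) {x : Fin d → ℝ} {δ : ℝ}
    (h : ∀ y ∈ cube d, |κ x y| ≤ δ) :
    |∫ y, κ x y * f y ∂cubeMeasure d| ≤ δ * ∫ y, |f y| ∂cubeMeasure d := by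
  rw [← integral_const_mul]
  refine (norm_integral_le_integral_norm _).trans
    (integral_mono_ae (integrable_continuous_mul
      (hκ.comp (by fun_prop : Continuous fun y => (x, y))) hf).norm (hf.abs.const_mul δ) ?_)
  filter_upwards [ae_restrict_mem (measurableSet_box _ _)] with y hy
  rw [norm_mul]
  exact mul_le_mul_of_nonneg_right (h y hy) (abs_nonneg _)

theorem exists_nhds_kernel_close (hκ : Continuous (Function.uncurry κ)) (x : Fin d → ℝ) {ε : ℝ}
    (hε : 0 < ε) : ∀ᶠ x' in nhds x, ∀ y ∈ cube d, |κ x' y - κ x y| ≤ ε := by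
  obtain ⟨v, hv, h⟩ := IsCompact.mem_uniformity_of_prod (s := Set.univ) (q := x)
    (isCompact_cube (d := d)) (f := κ) hκ.continuousOn (Set.mem_univ x)
    (Metric.dist_mem_uniformity hε)
  rw [nhdsWithin_univ] at hv
  filter_upwards [hv] with x' hx' y hy
  exact (h x' hx' y hy).le

/-- The image of an `L_1`-bounded sequence under an integral operator with continuous kernel has a
uniformly convergent subsequence. -/
theorem exists_subseq_integral_kernel (hκ : Continuous (Function.uncurry κ))
    {F : ℕ → (Fin d → ℝ) → ℝ} (hF : ∀ n, Integrable (F n) (cubeMeasure d)) {M : ℝ}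
    (hM : ∀ n, ∫ y, |F n y| ∂cubeMeasure d ≤ M) :
    ∃ (g : (Fin d → ℝ) → ℝ) (ψ : ℕ → ℕ) (δ : ℕ → ℝ≥0∞), ContinuousOn g (cube d) ∧
      StrictMono ψ ∧ Filter.Tendsto δ Filter.atTop (nhds 0) ∧
      ∀ n, ∀ x ∈ cube d, ‖∫ y, κ x y * F (ψ n) y ∂cubeMeasure d - g x‖ₑ ≤ δ n := by
  have : CompactSpace (cube d) := isCompact_iff_compactSpace.1 isCompact_cube
  have hM0 : 0 ≤ M := (integral_nonneg fun _ => abs_nonneg _).trans (hM 0)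
  have hclose : ∀ x : Fin d → ℝ, ∀ ε > 0, ∀ᶠ x' in nhds x, ∀ n,
      |∫ y, κ x' y * F n y ∂cubeMeasure d - ∫ y, κ x y * F n y ∂cubeMeasure d| < ε := by
    intro x ε hε
    -- The kernel oscillation is multiplied by an `L_1` norm of at most `M`; adding 1 covers `M = 0`
    -- and makes the bound strict. The resulting neighbourhood does not depend on `n`, which is
    -- equicontinuity.
    have hδ : 0 < ε / (M + 1) := by positivity
    filter_upwards [exists_nhds_kernel_close hκ x hδ] with x' hx' n
    refine (abs_integral_kernel_sub_le hκ (hF n) hx').trans_lt ?_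
    calc ε / (M + 1) * ∫ y, |F n y| ∂cubeMeasure d ≤ ε / (M + 1) * M :=
          mul_le_mul_of_nonneg_left (hM n) hδ.le
      _ < ε / (M + 1) * (M + 1) := mul_lt_mul_of_pos_left (lt_add_one M) hδ
      _ = ε := by field_simp
  have hcont : ∀ n, Continuous fun x : cube d => ∫ y, κ x y * F n y ∂cubeMeasure d := by
    intro n
    refine Continuous.comp (g := fun x => ∫ y, κ x y * F n y ∂cubeMeasure d)
      (Metric.continuous_iff'.2 fun x ε hε => ?_) continuous_subtype_val
    filter_upwards [hclose x ε hε] with x' hx'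
    exact hx' n
  let T : ℕ → BoundedContinuousFunction (cube d) ℝ := fun n =>
    BoundedContinuousFunction.mkOfCompact ⟨_, hcont n⟩
  obtain ⟨B, hB⟩ := (isCompact_cube.prod isCompact_cube).exists_bound_of_continuousOn
    (f := Function.uncurry κ) (s := cube d ×ˢ cube d) hκ.continuousOn
  have hcompact : IsCompact (closure (Set.range T)) := by
    refine BoundedContinuousFunction.arzela_ascoli (Set.Icc (-(|B| * M)) (|B| * M)) isCompact_Icc _
      ?_ ?_
    · rintro _ x ⟨n, rfl⟩
      rw [Set.mem_Icc, ← abs_le]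
      refine (abs_integral_kernel_le hκ (hF n) (δ := |B|) fun y hy => ?_).trans
        (mul_le_mul_of_nonneg_left (hM n) (abs_nonneg _))
      exact (hB (x, y) ⟨x.2, hy⟩).trans (le_abs_self B)
    · intro x
      rw [Metric.equicontinuousAt_iff_right]
      intro ε hε
      filter_upwards [continuous_subtype_val.continuousAt.eventually (hclose x ε hε)] with x' hx'
      rintro ⟨_, n, rfl⟩
      rw [dist_comm]
      exact hx' n
  obtain ⟨G, -, ψ, hψ, hG⟩ := hcompact.tendsto_subseq fun n => subset_closure ⟨n, rfl⟩
  classical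
  refine ⟨fun x => if h : x ∈ cube d then G ⟨x, h⟩ else 0, ψ,
    fun n => ENNReal.ofReal (dist (T (ψ n)) G), ?_, hψ, ?_, fun n x hx => ?_⟩
  · rw [continuousOn_iff_continuous_domRestrict]
    refine G.continuous.congr fun x => ?_
    simp
  · rw [← ENNReal.ofReal_zero]
    exact ENNReal.tendsto_ofReal (tendsto_iff_dist_tendsto_zero.1 hG)
  · simp only [dif_pos hx]
    rw [← ofReal_norm]
    exact ENNReal.ofReal_le_ofReal ((T (ψ n)).dist_coe_le_dist (g := G) ⟨x, hx⟩)

end Compactness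

/-! ### Whitney's inequality on the unit cube -/

theorem cube_subset_closure_interior : cube d ⊆ closure (interior (cube d)) := by
  rw [cube, box_eq_pi, interior_pi_set Set.finite_univ, closure_pi_set]
  refine Set.pi_mono fun i _ => ?_
  simp

theorem continuousOn_devCoord (k : Fin d) {m : ℕ} {g : (Fin d → ℝ) → ℝ}
    (hg : ContinuousOn g (cube d)) :
    ContinuousOn (devCoord k m g) (cube d ×ˢ cube d) := by
  unfold devCoord avgCoord
  refine (hg.comp continuousOn_fst fun w hw => hw.1).sub
    (continuousOn_finsetSum _ fun j hj => continuousOn_const.mul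
      (hg.comp (t := cube d) ?_ fun w hw => ?_))
  · unfold mixCoord
    fun_prop
  · have hj' : ((j + 1 : ℕ) : ℝ) ≤ m := by exact_mod_cast Finset.mem_range.1 hj
    exact (mixCoord_mem (by positivity) (div_le_one_of_le₀ hj' (by positivity)) hw).1

/-- The deviations are continuous on a set contained in the closure of its interior, so vanishing
almost everywhere means vanishing everywhere. -/
theorem exists_eval_eq_of_devCoord_ae_eq_zero {r : Fin d → ℕ} (hr : ∀ i, 1 ≤ r i)
    {g : (Fin d → ℝ) → ℝ} (hcont : ContinuousOn g (cube d))
    (hg : ∀ k, devCoord k (r k) g =ᵐ[pairMeasure d] 0) :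
    ∃ φ ∈ polys r, ∀ x ∈ cube d, g x = MvPolynomial.eval x φ := by
  refine exists_eval_eq_of_coordDiff_eq_zero hr hcont fun i x hx z hz => ?_
  have h1 := hg i
  rw [pairMeasure, Measure.prod_restrict] at h1
  have h2 : Set.EqOn (devCoord i (r i) g) 0 (cube d ×ˢ cube d) := by
    refine Measure.eqOn_of_ae_eq h1 (continuousOn_devCoord i hcont) continuousOn_const ?_
    rw [interior_prod_eq, closure_prod_eq]
    exact Set.prod_mono cube_subset_closure_interior cube_subset_closure_interior
  have h3 := coordDiff_eq_devCoord i (hr i) g (x, fun _ => z)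
  rw [h2 (show (x, fun _ => z) ∈ cube d ×ˢ cube d from ⟨hx, fun _ => hz⟩)] at h3
  simpa using h3

theorem devCoord_sub (k : Fin d) (m : ℕ) (f g : (Fin d → ℝ) → ℝ) :
    devCoord k m (fun x => f x - g x) = fun w => devCoord k m f w - devCoord k m g w := by
  funext w
  rw [devCoord, avgCoord_sub, devCoord, devCoord]
  ring

theorem devCoord_smul (k : Fin d) (m : ℕ) (c : ℝ) (f : (Fin d → ℝ) → ℝ) :
    devCoord k m (fun x => c * f x) = fun w => c * devCoord k m f w := by
  funext w
  rw [devCoord, avgCoord_smul, devCoord]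
  ring

theorem devCoord_eval {r : Fin d → ℕ} (hr : ∀ i, 1 ≤ r i) {φ : MvPolynomial (Fin d) ℝ}
    (hφ : φ ∈ polys r) (k : Fin d) :
    devCoord k (r k) (fun x => MvPolynomial.eval x φ) = fun _ => 0 := by
  funext w
  have h := coordDiff_eq_devCoord k (hr k) (fun x => MvPolynomial.eval x φ) w
  rw [coordDiff_eval_eq_zero hφ] at h
  simpa using h.symm

/-- Functions of bounded norm with small deviations in all coordinates are close to polynomials,
uniformly in the exponent. -/
theorem exists_approx_of_devCoord_le {r : Fin d → ℕ} (hr : ∀ i, 1 ≤ r i) :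
    ∃ ε : ℝ≥0∞, ε ≠ 0 ∧ ε ≠ ∞ ∧ ∀ p : ℝ≥0∞, 1 ≤ p → ∀ G : (Fin d → ℝ) → ℝ,
      AEStronglyMeasurable G (cubeMeasure d) → eLpNorm G p (cubeMeasure d) ≤ 2 →
      (∀ k, eLpNorm (devCoord k (r k) G) p (pairMeasure d) ≤ ε) →
      ∃ φ ∈ polys r, eLpNorm (fun x => G x - MvPolynomial.eval x φ) p (cubeMeasure d) < 1 := by
  by_contra hcon
  push Not at hcon
  have hn : ∀ n : ℕ, ((n : ℝ≥0∞) + 1)⁻¹ ≠ 0 := fun n =>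
    ENNReal.inv_ne_zero.2 (ENNReal.add_ne_top.2 ⟨ENNReal.natCast_ne_top n, ENNReal.one_ne_top⟩)
  -- Negation with `ε = 1 / (n + 1)`; the exponent `p n` depends on `n` too.
  choose p hp G hG hG2 hdev hφ using fun n : ℕ =>
    hcon ((n : ℝ≥0∞) + 1)⁻¹ (hn n) (ENNReal.inv_ne_top.2 (by simp))
  obtain ⟨κ, hκ, hker⟩ := exists_continuous_kernel hr
  obtain ⟨C, hC, hlist⟩ := exists_eLpNorm_sub_avgList_le hr (List.finRange d)
  -- `L_1` is the common ground for the varying exponents, the cube having measure 1.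
  have hG1 : ∀ n, eLpNorm (G n) 1 (cubeMeasure d) ≤ 2 := fun n =>
    (eLpNorm_le_eLpNorm_of_exponent_le (hp n) (hG n)).trans (hG2 n)
  have hint : ∀ n, Integrable (G n) (cubeMeasure d) := fun n =>
    memLp_one_iff_integrable.1 ⟨hG n, (hG1 n).trans_lt (by simp)⟩
  have hbd : ∀ n, ∫ y, |G n y| ∂cubeMeasure d ≤ 2 := fun n => by
    have h := integral_norm_eq_lintegral_enorm (hG n)
    simp only [Real.norm_eq_abs] at h
    rw [h, ← eLpNorm_one_eq_lintegral_enorm]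
    exact ENNReal.toReal_le_of_le_ofReal zero_le_two (by simpa using hG1 n)
  obtain ⟨g, ψ, δ, hgc, hψ, hδ, hlim⟩ := exists_subseq_integral_kernel hκ hint hbd
  have hgm : AEStronglyMeasurable g (cubeMeasure d) :=
    hgc.aestronglyMeasurable (measurableSet_box _ _)
  have hkm : ∀ n, AEStronglyMeasurable (fun x => ∫ y, κ x y * G n y ∂cubeMeasure d)
      (cubeMeasure d) := fun n => by
    refine AEStronglyMeasurable.integral_prod_right'
      (f := fun w : (Fin d → ℝ) × (Fin d → ℝ) => κ w.1 w.2 * G n w.2) ?_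
    exact hκ.aestronglyMeasurable.mul (hG n).comp_snd
  set B : ℝ≥0∞ := ENNReal.ofReal ((3 / 2) ^ d) * (C * d) with hBdef
  have hB : B ≠ ∞ := ENNReal.mul_ne_top ENNReal.ofReal_ne_top
    (ENNReal.mul_ne_top hC (ENNReal.natCast_ne_top d))
  -- The first term bounds the distance to the kernel image, where all `d` deviations are at most `1
  -- / (ψ n + 1)`; the second is the uniform distance from that image to `g`.
  let e : ℕ → ℝ≥0∞ := fun n => B * ((ψ n : ℝ≥0∞) + 1)⁻¹ + δ n
  have hinv : Filter.Tendsto (fun n => ((ψ n : ℝ≥0∞) + 1)⁻¹) Filter.atTop (nhds 0) := by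
    have h1 : Filter.Tendsto (fun n : ℕ => ((n : ℝ≥0∞) + 1)⁻¹) Filter.atTop (nhds 0) := by
      have := ENNReal.tendsto_inv_nat_nhds_zero.comp (Filter.tendsto_add_atTop_nat 1)
      refine this.congr fun n => ?_
      simp
    exact h1.comp hψ.tendsto_atTop
  have he : Filter.Tendsto e Filter.atTop (nhds 0) := by
    simpa using (ENNReal.Tendsto.const_mul hinv (Or.inr hB)).add hδ
  have hGg : ∀ n, eLpNorm (fun x => G (ψ n) x - g x) (p (ψ n)) (cubeMeasure d) ≤ e n := by
    intro n
    obtain ⟨h1, h2⟩ := hlist _ (hp (ψ n)) _ (hG (ψ n))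
    have h3 := eLpNorm_sub_kernel_le (hker _ (hint (ψ n))) ((hG (ψ n)).comp_fst.sub h1) (hp (ψ n))
    have h4 : eLpNorm (fun x => ∫ y, κ x y * G (ψ n) y ∂cubeMeasure d - g x) (p (ψ n))
        (cubeMeasure d) ≤ δ n := by
      refine (eLpNorm_le_of_ae_enorm_bound (C := δ n) ?_).trans ?_
      · filter_upwards [ae_restrict_mem (measurableSet_box _ _)] with x hx
        exact hlim n x hx
      · rw [measure_univ]
        simp
    have hsplit : (fun x => G (ψ n) x - g x) =
        (fun x => G (ψ n) x - ∫ y, κ x y * G (ψ n) y ∂cubeMeasure d) +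
          fun x => ∫ y, κ x y * G (ψ n) y ∂cubeMeasure d - g x := by
      funext x
      simp
    rw [hsplit]
    refine (eLpNorm_add_le ((hG _).sub (hkm _)) ((hkm _).sub hgm) (hp _)).trans
      (add_le_add (h3.trans ?_) h4)
    rw [hBdef, mul_assoc]
    refine mul_le_mul' le_rfl (h2.trans ?_)
    rw [mul_assoc]
    refine mul_le_mul' le_rfl ((Finset.sum_le_card_nsmul _ _ _ fun k _ => hdev (ψ n) k).trans ?_)
    simp
  have hzero : ∀ k, devCoord k (r k) g =ᵐ[pairMeasure d] 0 := by
    intro k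
    -- The vanishing is tested in `L_1`, a fixed exponent dominated by every `p (ψ n)`.
    rw [← eLpNorm_eq_zero_iff (eLpNorm_devCoord_le k (hr k) hgm le_rfl).1 one_ne_zero,
      ← nonpos_iff_eq_zero]
    have hlim0 : Filter.Tendsto (fun n => ((ψ n : ℝ≥0∞) + 1)⁻¹ + (1 + 2 ^ r k * r k) * e n)
        Filter.atTop (nhds 0) := by
      simpa using hinv.add (ENNReal.Tendsto.const_mul he (Or.inr (ENNReal.add_ne_top.2
        ⟨ENNReal.one_ne_top, ENNReal.mul_ne_top (by simp) (ENNReal.natCast_ne_top _)⟩)))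
    refine ge_of_tendsto' hlim0 fun n => ?_
    have hGm := eLpNorm_devCoord_le k (hr k) (hG (ψ n)) (hp (ψ n))
    have hsub := eLpNorm_devCoord_le k (hr k) ((hG (ψ n)).sub hgm) le_rfl
    have hsplit : devCoord k (r k) g = fun w => devCoord k (r k) (G (ψ n)) w -
        devCoord k (r k) (fun x => G (ψ n) x - g x) w := by
      rw [devCoord_sub]
      funext w
      ring
    rw [hsplit]
    refine (eLpNorm_sub_le hGm.1 hsub.1 le_rfl).trans (add_le_add ?_ ?_)
    · exact (eLpNorm_le_eLpNorm_of_exponent_le (hp (ψ n)) hGm.1).trans (hdev (ψ n) k)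
    · refine hsub.2.trans (mul_le_mul' le_rfl ?_)
      exact (eLpNorm_le_eLpNorm_of_exponent_le (hp (ψ n)) ((hG (ψ n)).sub hgm)).trans (hGg n)
  obtain ⟨φ, hφr, hgφ⟩ := exists_eval_eq_of_devCoord_ae_eq_zero hr hgc hzero
  obtain ⟨n, hn1⟩ := (he.eventually_lt_const (zero_lt_one (α := ℝ≥0∞))).exists
  refine absurd (hφ (ψ n) φ hφr) (not_le.2 (lt_of_le_of_lt (le_of_eq_of_le ?_ (hGg n)) hn1))
  refine eLpNorm_congr_ae ?_
  filter_upwards [ae_restrict_mem (measurableSet_box _ _)] with x hx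
  rw [hgφ x hx]

theorem bestError_le_eLpNorm {r : Fin d → ℕ} {p : ℝ≥0∞} {a b : Fin d → ℝ}
    {f : (Fin d → ℝ) → ℝ} {φ : MvPolynomial (Fin d) ℝ} (hφ : φ ∈ polys r) :
    bestError r p a b f ≤
      eLpNorm (fun x => f x - MvPolynomial.eval x φ) p (volume.restrict (box a b)) :=
  iInf₂_le φ hφ

/-- Whitney's inequality on the unit cube, with the coordinate deviations as moduli. -/
theorem exists_bestError_cube_le {r : Fin d → ℕ} (hr : ∀ i, 1 ≤ r i) :
    ∃ C : ℝ≥0∞, C ≠ ∞ ∧ ∀ p : ℝ≥0∞, 1 ≤ p → ∀ f : (Fin d → ℝ) → ℝ,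
      MemLp f p (cubeMeasure d) →
      bestError r p 0 1 f ≤ C * ∑ k, eLpNorm (devCoord k (r k) f) p (pairMeasure d) := by
  obtain ⟨ε, hε, hε', happrox⟩ := exists_approx_of_devCoord_le hr
  refine ⟨ε⁻¹, ENNReal.inv_ne_top.2 hε, fun p hp f hf => ?_⟩
  set B := bestError r p 0 1 f with hBdef
  have hBtop : B ≠ ∞ := by
    refine ne_top_of_le_ne_top hf.2.ne ?_
    have h0 : (0 : MvPolynomial (Fin d) ℝ) ∈ polys r := by simpa using C_mem_polys hr 0
    simpa using bestError_le_eLpNorm (p := p) (a := 0) (b := 1) (f := f) h0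
  rcases eq_or_ne B 0 with hB0 | hB0
  · rw [hB0]
    exact zero_le
  suffices H : ∃ k, ε * B ≤ eLpNorm (devCoord k (r k) f) p (pairMeasure d) by
    obtain ⟨k, hk⟩ := H
    calc B = ε⁻¹ * (ε * B) := by rw [← mul_assoc, ENNReal.inv_mul_cancel hε hε', one_mul]
      _ ≤ _ := mul_le_mul' le_rfl (hk.trans (Finset.single_le_sum
          (f := fun k => eLpNorm (devCoord k (r k) f) p (pairMeasure d))
          (fun _ _ => zero_le) (Finset.mem_univ k)))
  by_contra hcon
  push Not at hcon
  have hB2 : B < 2 * B := by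
    rw [two_mul]
    exact ENNReal.lt_add_right hBtop hB0
  -- A near-best polynomial: dividing `f - φ` by `B` gives norm at most 2, the bound required by
  -- `happrox`.
  obtain ⟨φ, hφ, hφB⟩ : ∃ φ ∈ polys r,
      eLpNorm (fun x => f x - MvPolynomial.eval x φ) p (cubeMeasure d) < 2 * B := by
    have h := hB2
    nth_rewrite 1 [hBdef] at h
    simpa only [bestError, iInf_lt_iff, exists_prop] using h
  set c : ℝ := B.toReal with hc
  have hcpos : 0 < c := ENNReal.toReal_pos hB0 hBtop
  have hcB : ‖c‖ₑ = B := by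
    rw [Real.enorm_of_nonneg hcpos.le, hc, ENNReal.ofReal_toReal hBtop]
  have hcinv : ‖c⁻¹‖ₑ = B⁻¹ := by rw [enorm_inv hcpos.ne', hcB]
  have hmul : ∀ {α : Type} [MeasurableSpace α] (μ : Measure α) (t : ℝ) (u : α → ℝ),
      eLpNorm (fun x => t * u x) p μ = ‖t‖ₑ * eLpNorm u p μ := fun μ t u =>
    eLpNorm_const_smul t u p μ
  have hfm : AEStronglyMeasurable (fun x => f x - MvPolynomial.eval x φ) (cubeMeasure d) :=
    hf.1.sub (measurable_eval φ).aestronglyMeasurable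
  have hnorm : eLpNorm (fun x => c⁻¹ * (f x - MvPolynomial.eval x φ)) p (cubeMeasure d) ≤ 2 := by
    rw [hmul, hcinv]
    calc B⁻¹ * _ ≤ B⁻¹ * (2 * B) := mul_le_mul' le_rfl hφB.le
      _ = 2 := by rw [mul_left_comm, ENNReal.inv_mul_cancel hB0 hBtop, mul_one]
  have hdev : ∀ k, eLpNorm (devCoord k (r k) fun x => c⁻¹ * (f x - MvPolynomial.eval x φ)) p
      (pairMeasure d) ≤ ε := fun k => by
    rw [devCoord_smul, hmul, hcinv, devCoord_sub, devCoord_eval hr hφ]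
    simp only [sub_zero]
    calc B⁻¹ * _ ≤ B⁻¹ * (ε * B) := mul_le_mul' le_rfl (hcon k).le
      _ = ε := by rw [mul_left_comm, ENNReal.inv_mul_cancel hB0 hBtop, mul_one]
  obtain ⟨χ, hχ, hlt⟩ := happrox p hp _ (hfm.const_mul _) hnorm hdev
  -- The corrected polynomial would approximate `f` with error strictly below the infimum `B`.
  have hmem : φ + MvPolynomial.C c * χ ∈ polys r := add_mem_polys hφ (C_mul_mem_polys hχ c)
  refine absurd (bestError_le_eLpNorm (p := p) (a := 0) (b := 1) (f := f) hmem) (not_le.2 ?_)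
  have heq : (fun x => f x - MvPolynomial.eval x (φ + MvPolynomial.C c * χ)) = fun x =>
      c * (c⁻¹ * (f x - MvPolynomial.eval x φ) - MvPolynomial.eval x χ) := by
    funext x
    rw [map_add, map_mul, MvPolynomial.eval_C, mul_sub, ← mul_assoc, mul_inv_cancel₀ hcpos.ne']
    ring
  rw [heq, hmul, hcB, ← hBdef]
  calc B * _ < B * 1 := (ENNReal.mul_lt_mul_iff_right hB0 hBtop).2 hlt
    _ = B := mul_one B

/-! ### Rescaling from the unit cube to a box -/

section Rescaling

variable {a b : Fin d → ℝ}

/-- The affine map of the unit cube onto the box with corners `a` and `b`. -/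
def toBox (a b x : Fin d → ℝ) : Fin d → ℝ := fun i => (b i - a i) * x i + a i

theorem measurable_toBox : Measurable (toBox a b) := by
  unfold toBox
  fun_prop

theorem toBox_mem (hab : ∀ i, a i < b i) {x : Fin d → ℝ} (hx : x ∈ cube d) :
    toBox a b x ∈ box a b := by
  intro i
  have hx' := hx i
  have h := hab i
  simp only [Pi.zero_apply, Pi.one_apply, Set.mem_Icc] at hx'
  simp only [toBox, Set.mem_Icc]
  constructor <;> nlinarith

theorem prod_side_pos (hab : ∀ i, a i < b i) : 0 < ∏ i, (b i - a i) :=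
  Finset.prod_pos fun i _ => sub_pos.2 (hab i)

theorem map_toBox (hab : ∀ i, a i < b i) :
    Measure.map (toBox a b) volume = ENNReal.ofReal (∏ i, (b i - a i))⁻¹ • volume := by
  have h := map_diagonal_affine (fun i => (sub_pos.2 (hab i)).ne') a
  rwa [abs_of_pos (inv_pos.2 (prod_side_pos hab))] at h

theorem memLp_comp_toBox (hab : ∀ i, a i < b i) {p : ℝ≥0∞} {f : (Fin d → ℝ) → ℝ}
    (hf : MemLp f p (volume.restrict (box a b))) :
    MemLp (f ∘ toBox a b) p (cubeMeasure d) := by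
  have hle := map_restrict_le measurable_toBox (map_toBox hab).le (measurableSet_box a b)
    (s := cube d) fun x hx => toBox_mem hab hx
  have hc : ENNReal.ofReal (∏ i, (b i - a i))⁻¹ ≠ 0 :=
    (ENNReal.ofReal_pos.2 (inv_pos.2 (prod_side_pos hab))).ne'
  refine ⟨aestronglyMeasurable_comp_of_map_le measurable_toBox hle hf.1,
    (eLpNorm_comp_le_of_map_le measurable_toBox hle hc hf.1 p).trans_lt
      (ENNReal.mul_lt_top ?_ hf.2)⟩
  exact ENNReal.rpow_lt_top_of_nonneg ENNReal.toReal_nonneg ENNReal.ofReal_ne_top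

/-- Coordinatewise affine substitutions preserve the partial degree bounds, so each competitor on
the cube transfers to the box. -/
theorem bestError_le_bestError_cube (hab : ∀ i, a i < b i) (r : Fin d → ℕ) {p : ℝ≥0∞}
    {f : (Fin d → ℝ) → ℝ} (hf : MemLp f p (volume.restrict (box a b))) :
    bestError r p a b f ≤ ENNReal.ofReal (∏ i, (b i - a i)) ^ (1 / p).toReal *
      bestError r p 0 1 (f ∘ toBox a b) := by
  have hV := prod_side_pos hab
  have hc : ENNReal.ofReal (∏ i, (b i - a i)) ≠ 0 := (ENNReal.ofReal_pos.2 hV).ne'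
  rw [bestError, bestError, ENNReal.mul_iInf_of_ne
    (ENNReal.rpow_pos hc.bot_lt ENNReal.ofReal_ne_top).ne'
    (ENNReal.rpow_lt_top_of_nonneg ENNReal.toReal_nonneg ENNReal.ofReal_ne_top).ne]
  refine le_iInf fun φ => ?_
  by_cases hφ : φ ∈ polys r
  swap
  · simp only [hφ, iInf_false]
    rw [ENNReal.mul_top (ENNReal.rpow_pos hc.bot_lt ENNReal.ofReal_ne_top).ne']
    exact le_top
  simp only [hφ, iInf_true]
  obtain ⟨ψ, hψ, hψφ⟩ := exists_eval_comp_affine hφ (fun i => (b i - a i)⁻¹)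
    fun i => -((b i - a i)⁻¹ * a i)
  let A' : (Fin d → ℝ) → (Fin d → ℝ) :=
    fun y i => (b i - a i)⁻¹ * y i + -((b i - a i)⁻¹ * a i)
  have hA'm : Measurable A' := by fun_prop
  have hinv : ∀ y, toBox a b (A' y) = y := fun y => by
    funext i
    have := (sub_pos.2 (hab i)).ne'
    simp only [toBox, A']
    field_simp
    ring
  have hmap : Measure.map A' volume = ENNReal.ofReal (∏ i, (b i - a i)) • volume := by
    have h := map_diagonal_affine (fun i => inv_ne_zero (sub_pos.2 (hab i)).ne')
      fun i => -((b i - a i)⁻¹ * a i)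
    rwa [Finset.prod_inv_distrib, inv_inv, abs_of_pos hV] at h
  have hmaps : Set.MapsTo A' (box a b) (cube d) := by
    intro y hy i
    have hi := sub_pos.2 (hab i)
    have hyi := hy i
    have : A' y i = (y i - a i) / (b i - a i) := by
      simp only [A']
      field_simp
      ring
    rw [this]
    exact ⟨div_nonneg (sub_nonneg.2 hyi.1) hi.le,
      (div_le_one hi).2 (sub_le_sub_right hyi.2 _)⟩
  refine (iInf₂_le ψ hψ).trans ?_
  have heq : (fun x => f x - MvPolynomial.eval x ψ) =
      (fun x => (f ∘ toBox a b) x - MvPolynomial.eval x φ) ∘ A' := by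
    funext y
    simp only [Function.comp_apply, hinv, hψφ]
    rfl
  rw [heq]
  exact eLpNorm_comp_le_of_map_le hA'm
    (map_restrict_le hA'm hmap.le (measurableSet_box 0 1) hmaps) hc
    ((memLp_comp_toBox hab hf).1.sub (measurable_eval φ).aestronglyMeasurable) p

/-- The pairs of a step and a point at which the difference of order `m` is taken in the
`p`-mean modulus with step bound `t`. -/
def stepDomain (m : Fin d → ℕ) (a b t : Fin d → ℝ) : Set ((Fin d → ℝ) × (Fin d → ℝ)) :=
  {w | w.1 ∈ stepSet t ∧ w.2 ∈ shiftBox a b fun i => (m i : ℝ) * w.1 i}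

theorem measurableSet_stepSet (t : Fin d → ℝ) : MeasurableSet (stepSet t) := by
  simp only [stepSet, Set.ofPred_forall]
  exact MeasurableSet.iInter fun i => measurableSet_le (by fun_prop) measurable_const

theorem measurableSet_stepDomain (m : Fin d → ℕ) (a b t : Fin d → ℝ) :
    MeasurableSet (stepDomain m a b t) := by
  have h3 : MeasurableSet {w : (Fin d → ℝ) × (Fin d → ℝ) |
      (fun i => w.2 i + (m i : ℝ) * w.1 i) ∈ box a b} :=
    (show Measurable fun (w : (Fin d → ℝ) × (Fin d → ℝ)) i => w.2 i + (m i : ℝ) * w.1 i by fun_prop)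
      (measurableSet_box a b)
  exact (measurable_fst (measurableSet_stepSet t)).inter
    ((measurable_snd (measurableSet_box a b)).inter h3)

/-- The step and the point that correspond to a pair of points of the unit cube. -/
noncomputable def toStep (r : Fin d → ℕ) (a b : Fin d → ℝ) (w : (Fin d → ℝ) × (Fin d → ℝ)) :
    (Fin d → ℝ) × (Fin d → ℝ) :=
  (fun i => (b i - a i) / r i * (w.2 i - w.1 i), toBox a b w.1)

theorem measurable_toStep (r : Fin d → ℕ) : Measurable (toStep r a b) := by
  unfold toStep toBox
  fun_prop

/-- The map factors into a fibrewise passage from `z` to the step, an exchange of the two factors,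
and a fibrewise rescaling of `x`. The densities of the two fibrewise maps multiply. -/
theorem map_toStep {r : Fin d → ℕ} (hr : ∀ i, 1 ≤ r i) (hab : ∀ i, a i < b i) :
    Measure.map (toStep r a b) (volume.prod volume) =
      (ENNReal.ofReal ((∏ i, (r i : ℝ)) * (∏ i, (b i - a i))⁻¹) *
        ENNReal.ofReal (∏ i, (b i - a i))⁻¹) • (volume : Measure (Fin d → ℝ)).prod volume := by
  have hr0 : ∀ i, (0 : ℝ) < r i := fun i => by exact_mod_cast hr i
  have hq : ∀ i, 0 < (b i - a i) / r i := fun i => div_pos (sub_pos.2 (hab i)) (hr0 i)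
  let g : (Fin d → ℝ) → (Fin d → ℝ) → (Fin d → ℝ) :=
    fun x z i => (b i - a i) / r i * (z i - x i)
  have hg : Measurable (Function.uncurry g) := by
    unfold g Function.uncurry
    fun_prop
  have hg' : Measurable fun w : (Fin d → ℝ) × (Fin d → ℝ) => (w.1, g w.1 w.2) :=
    measurable_fst.prodMk hg
  have hA : Measurable (Function.uncurry fun _ : Fin d → ℝ => toBox a b) :=
    measurable_toBox.comp measurable_snd
  have hA' : Measurable fun w : (Fin d → ℝ) × (Fin d → ℝ) => (w.1, toBox a b w.2) :=
    measurable_fst.prodMk hA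
  have hmap : ∀ x, Measure.map (g x) volume =
      ENNReal.ofReal ((∏ i, (r i : ℝ)) * (∏ i, (b i - a i))⁻¹) •
        (volume : Measure (Fin d → ℝ)) := by
    intro x
    have h := map_diagonal_affine (fun i => (hq i).ne') fun i => -((b i - a i) / r i * x i)
    rw [abs_of_pos (inv_pos.2 (Finset.prod_pos fun i _ => hq i)), Finset.prod_div_distrib,
      inv_div, div_eq_mul_inv] at h
    rw [← h]
    congr 1
    funext z i
    simp only [g]
    ring
  have hcomp : toStep r a b = (fun w : (Fin d → ℝ) × (Fin d → ℝ) => (w.1, toBox a b w.2)) ∘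
      Prod.swap ∘ fun w : (Fin d → ℝ) × (Fin d → ℝ) => (w.1, g w.1 w.2) := rfl
  rw [hcomp, ← Measure.map_map hA' (measurable_swap.comp hg'),
    ← Measure.map_map measurable_swap hg', map_prod_fiberwise hg hmap, Measure.map_smul,
    Measure.prod_swap, Measure.map_smul, map_prod_fiberwise hA fun _ => map_toBox hab, smul_smul]

/-- In direction `k` the full displacement leads exactly to the image of `z`; in the other
directions the order is 0 and the displacement is zero. -/
theorem toStep_mem {r : Fin d → ℕ} (hr : ∀ i, 1 ≤ r i) (hab : ∀ i, a i < b i) (k : Fin d)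
    {w : (Fin d → ℝ) × (Fin d → ℝ)} (hw : w ∈ cube d ×ˢ cube d) :
    toStep r a b w ∈ stepDomain (restrictOrder r {k}) a b fun i => b i - a i := by
  obtain ⟨h1, h2⟩ := hw
  refine ⟨fun i => ?_, toBox_mem hab h1, fun i => ?_⟩
  · have h1' := h1 i
    have h2' := h2 i
    have hi := sub_pos.2 (hab i)
    have hri : (1 : ℝ) ≤ r i := by exact_mod_cast hr i
    simp only [Pi.zero_apply, Pi.one_apply, Set.mem_Icc] at h1' h2'
    simp only [toStep]
    rw [abs_mul, abs_of_nonneg (div_nonneg hi.le (by linarith))]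
    have h3 : |w.2 i - w.1 i| ≤ 1 := abs_le.2 ⟨by linarith, by linarith⟩
    calc (b i - a i) / r i * |w.2 i - w.1 i| ≤ (b i - a i) / r i * 1 :=
          mul_le_mul_of_nonneg_left h3 (div_nonneg hi.le (by linarith))
      _ ≤ b i - a i := by
          rw [mul_one]
          exact div_le_self hi.le hri
  · rcases eq_or_ne i k with rfl | hik
    · have hri : (r i : ℝ) ≠ 0 := by
        have := hr i
        positivity
      have : (toStep r a b w).2 i + (restrictOrder r {i} i : ℝ) * (toStep r a b w).1 i =
          toBox a b w.2 i := by
        simp only [toStep, toBox, restrictOrder, Finset.mem_singleton, if_true]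
        field_simp
        ring
      rw [this]
      exact toBox_mem hab h2 i
    · simpa [restrictOrder, hik, toStep] using toBox_mem hab h1 i

theorem devCoord_comp_toBox {r : Fin d → ℕ} (hr : ∀ i, 1 ≤ r i) (k : Fin d)
    (f : (Fin d → ℝ) → ℝ) (w : (Fin d → ℝ) × (Fin d → ℝ)) :
    (-1) ^ r k * devCoord k (r k) (f ∘ toBox a b) w =
      coordDiff k (r k) ((toStep r a b w).1 k) f (toStep r a b w).2 := by
  rw [← coordDiff_eq_devCoord k (hr k)]
  simp only [coordDiff, Function.comp_apply]
  refine Finset.sum_congr rfl fun j _ => ?_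
  congr 2
  funext i
  rcases eq_or_ne i k with rfl | hik
  · simp only [toBox, toStep, Function.update_self]
    ring
  · simp [toBox, toStep, hik]

theorem measurable_coordDiff_uncurry (k : Fin d) (m : ℕ) {f : (Fin d → ℝ) → ℝ}
    (hf : Measurable f) :
    Measurable fun w : (Fin d → ℝ) × (Fin d → ℝ) => coordDiff k m (w.1 k) f w.2 := by
  unfold coordDiff
  refine Finset.measurable_fun_sum _ fun j _ => measurable_const.mul (hf.comp ?_)
  exact measurable_update_of measurable_snd (by fun_prop) k

/-- For finite `p` this is Tonelli, the volume factor undoing the normalization of the modulus. For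
`p = ∞` the bound holds for almost every point at each fixed step, hence for almost every pair; this
passage uses joint measurability. -/
theorem eLpNorm_coordDiff_stepDomain_le (r : Fin d → ℕ) {p : ℝ≥0∞} (hp : 1 ≤ p)
    {t : Fin d → ℝ} (ht : ∀ i, 0 < t i) {f : (Fin d → ℝ) → ℝ} (hf : Measurable f)
    (k : Fin d) :
    eLpNorm (fun w : (Fin d → ℝ) × (Fin d → ℝ) => coordDiff k (r k) (w.1 k) f w.2) p
      ((volume.prod volume).restrict (stepDomain (restrictOrder r {k}) a b t)) ≤
      ENNReal.ofReal (∏ i, t i) ^ (1 / p).toReal * meanModulus (restrictOrder r {k}) p a b f t := by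
  have hS := measurableSet_stepDomain (restrictOrder r {k}) a b t
  have hm := measurable_coordDiff_uncurry k (r k) hf
  have hprod : 0 < ∏ i, t i := Finset.prod_pos fun i _ => ht i
  unfold meanModulus
  split_ifs with hp'
  · subst hp'
    simp only [ENNReal.div_top, ENNReal.toReal_zero, ENNReal.rpow_zero, one_mul]
    rw [eLpNorm_exponent_top]
    set N := ⨆ h ∈ stepSet t, eLpNorm (mixedDiff (restrictOrder r {k}) h f) ∞
      (volume.restrict (shiftBox a b fun i => (restrictOrder r {k} i : ℝ) * h i)) with hN
    refine eLpNormEssSup_le_of_ae_enorm_bound ((ae_restrict_iff' hS).2 ?_)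
    have hle : MeasurableSet {w : (Fin d → ℝ) × (Fin d → ℝ) |
        ‖coordDiff k (r k) (w.1 k) f w.2‖ₑ ≤ N} := measurableSet_le hm.enorm measurable_const
    have hset : MeasurableSet {w : (Fin d → ℝ) × (Fin d → ℝ) |
        w ∈ stepDomain (restrictOrder r {k}) a b t →
          ‖coordDiff k (r k) (w.1 k) f w.2‖ₑ ≤ N} := by
      convert hS.compl.union hle using 1
      ext w
      exact imp_iff_not_or
    refine (Measure.ae_prod_iff_ae_ae hset).2 (Filter.Eventually.of_forall fun h => ?_)
    by_cases hh : h ∈ stepSet t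
    · have h1 : eLpNorm (mixedDiff (restrictOrder r {k}) h f) ∞
          (volume.restrict (shiftBox a b fun i => (restrictOrder r {k} i : ℝ) * h i)) ≤ N :=
        le_iSup₂_of_le h hh le_rfl
      rw [eLpNorm_exponent_top, mixedDiff_restrictOrder_singleton] at h1
      have h2 := ae_le_eLpNormEssSup (f := coordDiff k (r k) (h k) f)
        (μ := volume.restrict (shiftBox a b fun i => (restrictOrder r {k} i : ℝ) * h i))
      filter_upwards [(ae_restrict_iff' (measurableSet_shiftBox _ _ _)).1 h2] with x hx hw
      exact (hx hw.2).trans h1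
    · exact Filter.Eventually.of_forall fun x hw => absurd hw.1 hh
  · have hp0 : p ≠ 0 := (zero_lt_one.trans_le hp).ne'
    have hpos : 0 < p.toReal := ENNReal.toReal_pos hp0 hp'
    have hone : (1 / p).toReal = 1 / p.toReal := by simp
    rw [hone, ← ENNReal.mul_rpow_of_nonneg _ _ (by positivity), ← mul_assoc,
      ← ENNReal.ofReal_mul hprod.le, Finset.prod_inv_distrib, mul_inv_cancel₀ hprod.ne',
      ENNReal.ofReal_one, one_mul, eLpNorm_eq_lintegral_rpow_enorm_toReal hp0 hp']
    refine ENNReal.rpow_le_rpow (le_of_eq ?_) (by positivity)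
    rw [← lintegral_indicator hS, lintegral_prod _
      ((hm.enorm.pow_const _).indicator hS).aemeasurable,
      ← lintegral_indicator (measurableSet_stepSet t)]
    refine lintegral_congr fun h => ?_
    by_cases hh : h ∈ stepSet t
    · rw [Set.indicator_of_mem hh, mixedDiff_restrictOrder_singleton,
        ← lintegral_indicator (measurableSet_shiftBox _ _ _)]
      refine lintegral_congr fun x => ?_
      by_cases hx : x ∈ shiftBox a b fun i => (restrictOrder r {k} i : ℝ) * h i
      · rw [Set.indicator_of_mem hx, Set.indicator_of_mem
          (show (h, x) ∈ stepDomain (restrictOrder r {k}) a b t from ⟨hh, hx⟩),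
          ← ENNReal.ofReal_rpow_of_nonneg (abs_nonneg _) hpos.le, ← Real.enorm_eq_ofReal_abs]
      · rw [Set.indicator_of_notMem hx, Set.indicator_of_notMem fun hw => hx hw.2]
    · rw [Set.indicator_of_notMem hh]
      simp only [Set.indicator_of_notMem (fun hw => hh hw.1 :
        (h, _) ∉ stepDomain (restrictOrder r {k}) a b t), lintegral_zero]

theorem eLpNorm_devCoord_le_meanModulus {r : Fin d → ℕ} (hr : ∀ i, 1 ≤ r i)
    (hab : ∀ i, a i < b i) {p : ℝ≥0∞} (hp : 1 ≤ p) {f : (Fin d → ℝ) → ℝ} (hf : Measurable f)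
    (k : Fin d) :
    ENNReal.ofReal (∏ i, (b i - a i)) ^ (1 / p).toReal *
      eLpNorm (devCoord k (r k) (f ∘ toBox a b)) p (pairMeasure d) ≤
      ENNReal.ofReal (∏ i, (r i : ℝ)) *
        meanModulus (restrictOrder r {k}) p a b f fun i => b i - a i := by
  have hV := prod_side_pos hab
  have hR : (1 : ℝ) ≤ ∏ i, (r i : ℝ) := by
    exact_mod_cast Finset.one_le_prod' fun i _ => hr i
  set V := ∏ i, (b i - a i) with hVdef
  set R := ∏ i, (r i : ℝ) with hRdef
  have hc : ENNReal.ofReal (R * V⁻¹) * ENNReal.ofReal V⁻¹ ≠ 0 :=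
    mul_ne_zero (ENNReal.ofReal_pos.2 (by positivity)).ne'
      (ENNReal.ofReal_pos.2 (by positivity)).ne'
  have hle : Measure.map (toStep r a b) (pairMeasure d) ≤
      (ENNReal.ofReal (R * V⁻¹) * ENNReal.ofReal V⁻¹) • (volume.prod volume).restrict
        (stepDomain (restrictOrder r {k}) a b fun i => b i - a i) := by
    rw [pairMeasure, Measure.prod_restrict]
    exact map_restrict_le (measurable_toStep r) (map_toStep hr hab).le
      (measurableSet_stepDomain _ _ _ _) fun w hw => toStep_mem hr hab k hw
  have hdev : eLpNorm (devCoord k (r k) (f ∘ toBox a b)) p (pairMeasure d) =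
      eLpNorm ((fun w : (Fin d → ℝ) × (Fin d → ℝ) => coordDiff k (r k) (w.1 k) f w.2) ∘
        toStep r a b) p (pairMeasure d) := by
    refine eLpNorm_congr_norm_ae (Filter.Eventually.of_forall fun w => ?_)
    rw [Function.comp_apply, ← devCoord_comp_toBox hr k f w, norm_mul, norm_pow, norm_neg,
      norm_one, one_pow, one_mul]
  rw [hdev]
  calc _ ≤ ENNReal.ofReal V ^ (1 / p).toReal *
        ((ENNReal.ofReal (R * V⁻¹) * ENNReal.ofReal V⁻¹) ^ (1 / p).toReal *
          (ENNReal.ofReal V ^ (1 / p).toReal *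
            meanModulus (restrictOrder r {k}) p a b f fun i => b i - a i)) := by
        refine mul_le_mul' le_rfl ((eLpNorm_comp_le_of_map_le (measurable_toStep r) hle hc
          (measurable_coordDiff_uncurry k (r k) hf).aestronglyMeasurable p).trans
          (mul_le_mul' le_rfl ?_))
        exact eLpNorm_coordDiff_stepDomain_le r hp (fun i => sub_pos.2 (hab i)) hf k
    -- The volume cancels: `V * (R * V⁻¹ * V⁻¹) * V = R`.
    _ = ENNReal.ofReal R ^ (1 / p).toReal *
          meanModulus (restrictOrder r {k}) p a b f fun i => b i - a i := by
        rw [← mul_assoc, ← mul_assoc, ← ENNReal.mul_rpow_of_nonneg _ _ ENNReal.toReal_nonneg,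
          ← ENNReal.mul_rpow_of_nonneg _ _ ENNReal.toReal_nonneg,
          ← ENNReal.ofReal_mul (by positivity), ← ENNReal.ofReal_mul hV.le,
          ← ENNReal.ofReal_mul (by positivity)]
        congr 3
        field_simp
    _ ≤ _ := mul_le_mul' (rpow_one_div_toReal_le (ENNReal.one_le_ofReal.2 hR) hp) le_rfl

theorem sum_meanModulus_singleton_le (r : Fin d → ℕ) (p : ℝ≥0∞) (f : (Fin d → ℝ) → ℝ)
    (t : Fin d → ℝ) :
    ∑ k, meanModulus (restrictOrder r {k}) p a b f t ≤ totalMeanModulus r p a b f t := by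
  unfold totalMeanModulus
  rw [← Finset.sum_image (s := Finset.univ) (g := fun k : Fin d => ({k} : Finset (Fin d)))
    (f := fun e => meanModulus (restrictOrder r e) p a b f t)
    fun k _ l _ h => Finset.singleton_injective h]
  refine Finset.sum_le_sum_of_subset fun e he => ?_
  obtain ⟨k, -, rfl⟩ := Finset.mem_image.1 he
  simp

end Rescaling

/-! ### The upper estimate on boxes and the two-sided theorem -/

/-- Whitney's inequality on boxes: the error of best approximation is bounded by the total mixed
`p`-mean modulus, with a constant independent of the exponent and of the box. -/
theorem exists_bestError_le_totalMeanModulus {r : Fin d → ℕ} (hr : ∀ i, 1 ≤ r i) :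
    ∃ C : ℝ≥0∞, C ≠ ∞ ∧ ∀ p : ℝ≥0∞, 1 ≤ p → ∀ a b : Fin d → ℝ, (∀ i, a i < b i) →
      ∀ f : (Fin d → ℝ) → ℝ, MemLp f p (volume.restrict (box a b)) →
        bestError r p a b f ≤ C * totalMeanModulus r p a b f fun i => b i - a i := by
  obtain ⟨C, hC, hcube⟩ := exists_bestError_cube_le hr
  refine ⟨C * ENNReal.ofReal (∏ i, (r i : ℝ)), ENNReal.mul_ne_top hC ENNReal.ofReal_ne_top,
    fun p hp a b hab f hf => ?_⟩
  -- A measurable representative makes the differences jointly measurable in step and point; neither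
  -- side of the inequality sees the change.
  obtain ⟨g, hg, hfg⟩ := hf.1
  have hgL : MemLp g p (volume.restrict (box a b)) := (memLp_congr_ae hfg).1 hf
  have hE : bestError r p a b f = bestError r p a b g := by
    refine iInf_congr fun φ => iInf_congr fun _ => eLpNorm_congr_ae ?_
    filter_upwards [hfg] with x hx
    rw [hx]
  have hW : totalMeanModulus r p a b f (fun i => b i - a i) =
      totalMeanModulus r p a b g fun i => b i - a i :=
    Finset.sum_congr rfl fun e _ => meanModulus_congr_ae _ p hfg _
  rw [hE, hW]
  calc bestError r p a b g ≤ ENNReal.ofReal (∏ i, (b i - a i)) ^ (1 / p).toReal *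
        (C * ∑ k, eLpNorm (devCoord k (r k) (g ∘ toBox a b)) p (pairMeasure d)) :=
        (bestError_le_bestError_cube hab r hgL).trans
          (mul_le_mul' le_rfl (hcube p hp _ (memLp_comp_toBox hab hgL)))
    _ = C * ∑ k, ENNReal.ofReal (∏ i, (b i - a i)) ^ (1 / p).toReal *
          eLpNorm (devCoord k (r k) (g ∘ toBox a b)) p (pairMeasure d) := by
        rw [mul_left_comm, Finset.mul_sum]
    _ ≤ C * ∑ k, ENNReal.ofReal (∏ i, (r i : ℝ)) *
          meanModulus (restrictOrder r {k}) p a b g fun i => b i - a i :=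
        mul_le_mul' le_rfl (Finset.sum_le_sum fun k _ =>
          eLpNorm_devCoord_le_meanModulus hr hab hp hg.measurable k)
    _ ≤ _ := by
        rw [← Finset.mul_sum, mul_assoc]
        exact mul_le_mul' le_rfl (mul_le_mul' le_rfl (sum_meanModulus_singleton_le r p g _))

end Whitney

theorem mainTheorem4 (d : ℕ) (r : Fin d → ℕ) (hr : ∀ i, 1 ≤ r i) :
    ∃ C C' : ℝ, 0 < C ∧ 0 < C' ∧
      ∀ p : ℝ≥0∞, 1 ≤ p →
      ∀ a b : Fin d → ℝ, (∀ i, a i < b i) →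
      ∀ f : (Fin d → ℝ) → ℝ, MemLp f p (volume.restrict (Whitney.box a b)) →
        ENNReal.ofReal C * Whitney.totalMeanModulus r p a b f (fun i => b i - a i)
            ≤ Whitney.bestError r p a b f ∧
        Whitney.bestError r p a b f
            ≤ ENNReal.ofReal C' * Whitney.totalMeanModulus r p a b f (fun i => b i - a i) := by
  obtain ⟨K, hK, hupper⟩ := Whitney.exists_bestError_le_totalMeanModulus hr
  -- The first constant inverts that of the lower estimate; adding 1 to `K` ensures positivity of
  -- the second.
  refine ⟨(2 ^ d * (2 ^ d * 2 ^ (∑ i, r i)))⁻¹, K.toReal + 1, by positivity, by positivity,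
    fun p hp a b hab f hf => ⟨?_, ?_⟩⟩
  · have hcast : ENNReal.ofReal (2 ^ d * (2 ^ d * 2 ^ (∑ i, r i)))⁻¹ =
        (2 ^ d * (2 ^ d * 2 ^ (∑ i, r i)) : ℝ≥0∞)⁻¹ := by
      rw [ENNReal.ofReal_inv_of_pos (by positivity), ENNReal.ofReal_mul (by positivity),
        ENNReal.ofReal_mul (by positivity), ENNReal.ofReal_pow zero_le_two,
        ENNReal.ofReal_pow zero_le_two]
      simp
    have h0 : (2 ^ d * (2 ^ d * 2 ^ (∑ i, r i)) : ℝ≥0∞) ≠ 0 := by positivity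
    have htop : (2 ^ d * (2 ^ d * 2 ^ (∑ i, r i)) : ℝ≥0∞) ≠ ∞ :=
      ENNReal.mul_ne_top (by simp) (ENNReal.mul_ne_top (by simp) (by simp))
    rw [hcast]
    refine (mul_le_mul' le_rfl (Whitney.totalMeanModulus_le_bestError r hp hab hf.1)).trans ?_
    rw [← mul_assoc, ENNReal.inv_mul_cancel h0 htop, one_mul]
  · refine (hupper p hp a b hab f hf).trans (mul_le_mul' ?_ le_rfl)
    rw [← ENNReal.ofReal_toReal hK]
    exact ENNReal.ofReal_le_ofReal (by simp)
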